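/- Let $p$ be a prime and $c\ge 2$ an integer. Let $\mathbb F_p\langle X_1,X_2\rangle$ be the free associative $\mathbb F_p$-algebra, with bracket $[P,Q]=PQ-QP$, let $\mathcal L$ be its Lie subalgebra generated by $X_1,X_2$ (the free Lie algebra on two generators), and let $L=\mathfrak f_{c,2}(\mathbb F_p)=\mathcal L/\gamma_{c+1}(\mathcal L)$ be the free class-$c$ nilpotent $\mathbb F_p$-Lie algebra on two generators. Write $L=L_1\oplus\cdots\oplus L_c$, where $L_k$ is the image of the space of homogeneous Lie polynomials of degree $k$, put $d_k=\dim L_k$ and $\phi_i(w)=[X_i,w]$ for $i=1,2$, and for $1\le k\le c-1$ let $l_{k+1}=\dim(\phi_1(L_k)\cap\phi_2(L_k))$. Let $f_k(m,i,p)$ be the number of subspaces $V\le L_k$ with $\dim V=m$ and $\dim(\phi_1(V)\cap\phi_2(V))=i$. For $1\le k\le c-1$ a one-step graded ideal of $L$ at level $k$ is an ideal of the form $I=0\oplus\cdots\oplus0\oplus I_k\oplus I_{k+1}\oplus L_{k+2}\oplus\cdots\oplus L_c$ with $I_k\le L_k$, $I_{k+1}\le L_{k+1}$. Let $\alpha_1(a,k,p)$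 be the number of such ideals with $\dim I_k+\dim I_{k+1}=a$, where $a\ge0$ is an integer. For integers $n,i$ let $\binom{n}{i}_p=1$ if $i=0$, $\binom{n}{i}_p=\frac{(1-p^n)(1-p^{n-1})\cdots(1-p^{n-i+1})}{(1-p)(1-p^2)\cdots(1-p^i)}$ if $0<i\le n$, and $\binom{n}{i}_p=0$ otherwise. Theorem. Fix integers $c\ge2$, $1\le k\le c-1$ and $a\ge 0$. (1) If $k\ge2$, then for every prime $p\ge c$ \[\alpha_1(a,k,p)=\sum_{m=0}^{d_k}\ \sum_{i=0}^{\min(m,\,l_{k+1})}f_k(m,i,p)\binom{d_{k+1}-(2m-i)}{a-m-(2m-i)}_{p}.\] (2) $\alpha_1(a,k,p)$ is uniformly given by a polynomial in $p$: there is a polynomial $P\in\mathbb Q[x]$, depending only on $c$, $k$ and $a$, such that $\alpha_1(a,k,p)=P(p)$ for every prime $p\ge c$. -/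

import Mathlib

open Polynomial

attribute [local instance 100] LieRing.ofAssociativeRing

noncomputable section

namespace GradedIdeals

/-- The free Lie algebra on two letters over `𝔽_p`, realised as the Lie subalgebra (for
`[P, Q] = P Q - Q P`) of the free associative algebra `𝔽_p⟨X_1, X_2⟩` generated by the letters. -/
abbrev freeLie (p : ℕ) : LieSubalgebra (ZMod p) (FreeAlgebra (ZMod p) (Fin 2)) :=
  LieSubalgebra.lieSpan (ZMod p) (FreeAlgebra (ZMod p) (Fin 2))
    (Set.range (FreeAlgebra.ι (ZMod p)))

/-- The letter `X_i` as an element of the free Lie algebra. -/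
def freeGen (p : ℕ) (i : Fin 2) : freeLie p :=
  ⟨FreeAlgebra.ι (ZMod p) i, LieSubalgebra.subset_lieSpan (Set.mem_range_self i)⟩

/-- Homogeneous noncommutative polynomials of degree `k`, i.e. the span of the words of
length `k`, as the `k`-th power of the span of the letters. -/
def words (p k : ℕ) : Submodule (ZMod p) (FreeAlgebra (ZMod p) (Fin 2)) :=
  Submodule.span (ZMod p) (Set.range (FreeAlgebra.ι (ZMod p) : Fin 2 → _)) ^ k

/-- Lie polynomials which are homogeneous of weight `k`. -/
def freeLieComp (p k : ℕ) : Submodule (ZMod p) (freeLie p) :=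
  (words p k).comap (freeLie p).toSubmodule.subtype

/-- The free class-`c` nilpotent Lie algebra on two generators over `𝔽_p`: the quotient of the
free Lie algebra by the `(c+1)`-st term of its lower central series
(Mathlib numbers the lower central series from `0`). -/
abbrev FreeNilp (p c : ℕ) : Type :=
  freeLie p ⧸ LieModule.lowerCentralSeries (ZMod p) (freeLie p) (freeLie p) c

/-- The quotient map onto the free class-`c` nilpotent Lie algebra. -/
def proj (p c : ℕ) : freeLie p →ₗ[ZMod p] FreeNilp p c :=
  (LieSubmodule.Quotient.mk' (LieModule.lowerCentralSeries (ZMod p) (freeLie p) (freeLie p) c) :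
    freeLie p →ₗ[ZMod p] FreeNilp p c)

/-- The homogeneous component `L_k` of `L = FreeNilp p c`. -/
def lieComp (p c k : ℕ) : Submodule (ZMod p) (FreeNilp p c) :=
  (freeLieComp p k).map (proj p c)

/-- `φ_i : L → L`, `w ↦ [X_i, w]` (the indices `1, 2` are `0, 1 : Fin 2` here). -/
def phi (p c : ℕ) (i : Fin 2) : FreeNilp p c →ₗ[ZMod p] FreeNilp p c :=
  (LieAlgebra.ad (ZMod p) (FreeNilp p c) (proj p c (freeGen p i)) :
    FreeNilp p c →ₗ[ZMod p] FreeNilp p c)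

/-- `d_k = dim L_k`. -/
def d (p c k : ℕ) : ℕ := Module.finrank (ZMod p) (lieComp p c k)

/-- The dimension of collapse `dim (φ_1(V) ∩ φ_2(V))`. -/
def dimCol (p c : ℕ) (V : Submodule (ZMod p) (FreeNilp p c)) : ℕ :=
  Module.finrank (ZMod p)
    (V.map (phi p c 0) ⊓ V.map (phi p c 1) : Submodule (ZMod p) (FreeNilp p c))

/-- `ell p c k` is `l_{k+1} = dim (φ_1(L_k) ∩ φ_2(L_k))`. -/
def ell (p c k : ℕ) : ℕ := dimCol p c (lieComp p c k)

/-- `f_k(m, i, p)`: the number of subspaces of `L_k` of dimension `m` with dimension of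
collapse `i`. -/
def f (p c k m i : ℕ) : ℕ :=
  Set.ncard {V : Submodule (ZMod p) (FreeNilp p c) |
    V ≤ lieComp p c k ∧ Module.finrank (ZMod p) V = m ∧ dimCol p c V = i}

/-- One-step graded ideals at level `k`: ideals of the form
`0 ⊕ ⋯ ⊕ 0 ⊕ I_k ⊕ I_{k+1} ⊕ L_{k+2} ⊕ ⋯ ⊕ L_c` with `I_k ≤ L_k` and `I_{k+1} ≤ L_{k+1}`. -/
def IsOneStepGraded (p c k : ℕ) (I : LieIdeal (ZMod p) (FreeNilp p c)) : Prop :=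
  ∃ J J' : Submodule (ZMod p) (FreeNilp p c), J ≤ lieComp p c k ∧ J' ≤ lieComp p c (k + 1) ∧
    I.toSubmodule = J ⊔ J' ⊔ ⨆ j ∈ Set.Icc (k + 2) c, lieComp p c j

/-- `α_1(a, k, p)`: the number of one-step graded ideals `I` at level `k` with
`dim I_k + dim I_{k+1} = a`, where `I_j = I ∩ L_j`. -/
def alphaOne (p c k a : ℕ) : ℕ :=
  Set.ncard {I : LieIdeal (ZMod p) (FreeNilp p c) | IsOneStepGraded p c k I ∧
    Module.finrank (ZMod p) (I.toSubmodule ⊓ lieComp p c k : Submodule (ZMod p) (FreeNilp p c)) +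
    Module.finrank (ZMod p)
      (I.toSubmodule ⊓ lieComp p c (k + 1) : Submodule (ZMod p) (FreeNilp p c)) = a}

/-- The Gaussian binomial coefficient for integers `n, i`: it is `1` if `i = 0`,
`((1 - q^n) ⋯ (1 - q^(n-i+1))) / ((1 - q) ⋯ (1 - q^i))` if `0 < i ≤ n`, and `0` otherwise. -/
def gaussBinom (n i : ℤ) (q : ℚ) : ℚ :=
  if i = 0 then 1
  else if 0 < i ∧ i ≤ n then
    (∏ j ∈ Finset.range i.toNat, (1 - q ^ (n.toNat - j))) /
      ∏ j ∈ Finset.range i.toNat, (1 - q ^ (j + 1))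
  else 0

end GradedIdeals

end

/-! An ideal of the required shape is a pair of subspaces `J ≤ L_k` and `J' ≤ L_{k+1}` with φ₁(J) +
φ₂(J) ≤ J', because everything of weight at least k+2 is already included. For fixed `J` the
admissible `J'` form an interval of subspaces, counted by a Gaussian binomial. For k ≥ 2 both φ_i
are injective on `L_k`, so dim(φ₁(J) + φ₂(J)) = 2m - i, where m = dim J and i is the dimension of
collapse. Grouping the `J` by (m, i) gives the formula (`alphaOne_formula`).

The structural input is the chain condition `phi_chain`: if φ₁u = φ₂v and φ₁v = φ₂w in weight k ≥ 2,
then u = w = 0. In the free associative algebra these equations force the coefficients of u and w to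
be symmetric in the last two letters. The Dynkin operator then kills u and w, since its innermost
bracket is antisymmetric. On Lie elements of degree k it is multiplication by k, which is invertible
because k < c ≤ p. Injectivity of the φ_i is the special case of a chain padded with zeros.

Polynomiality of `f` comes from counting pairs (V, S) with S ≤ φ₁(V) ∩ φ₂(V), dim V = m and dim S =
e. By the chain condition, S determines a subspace `hull` of dimension 2e, and the condition on V is
just that V contains it, so the number of pairs is a product of two Gaussian binomials
(`sum_f_mul_gaussBinom`). Counting by V instead gives a unitriangular system for f(m, i), solved by
descending induction on e (`exists_f_poly`).

It remains that d_k does not depend on p (`exists_d_eq`). For k ≥ 2 this is the rank of an integer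
matrix M, a Dynkin operator weighted by one letter, with M² = MD for a diagonal D invertible modulo
p. Then M and D - M have complementary ranks, and neither rank can drop modulo p. Since d_{k+1} +
l_{k+1} = 2d_k for k ≥ 2, the number l_{k+1} is independent of p as well. In weight 1 the φ_i are
not injective and the count is made directly. -/

noncomputable section

namespace GradedIdeals

/-! ### Coefficients of words in the free associative algebra. -/

section Words

variable (R : Type*) [CommRing R]

/-- The noncommutative monomial attached to a word. -/
def monom (w : List (Fin 2)) : FreeAlgebra R (Fin 2) := (w.map (FreeAlgebra.ι R)).prod

@[simp] lemma monom_nil : monom R [] = 1 := rfl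

@[simp] lemma monom_cons (s : Fin 2) (w : List (Fin 2)) :
    monom R (s :: w) = FreeAlgebra.ι R s * monom R w := by
  simp [monom]

lemma monom_append (v w : List (Fin 2)) : monom R (v ++ w) = monom R v * monom R w := by
  simp [monom]

/-- The basis of monomials. -/
def wordBasis : Module.Basis (List (Fin 2)) R (FreeAlgebra R (Fin 2)) :=
  (FreeAlgebra.basisFreeMonoid R (Fin 2)).reindex FreeMonoid.toList

@[simp] lemma wordBasis_apply (w : List (Fin 2)) : wordBasis R w = monom R w := by
  simp [wordBasis, FreeAlgebra.basisFreeMonoid, monom,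
    FreeAlgebra.equivMonoidAlgebraFreeMonoid, FreeMonoid.lift_apply]

variable {R}

/-- The coefficient of a word. -/
def coeff (w : List (Fin 2)) : FreeAlgebra R (Fin 2) →ₗ[R] R := (wordBasis R).coord w

lemma coeff_monom (w v : List (Fin 2)) : coeff w (monom R v) = if v = w then 1 else 0 := by
  rw [← wordBasis_apply, coeff, Module.Basis.coord_apply, Module.Basis.repr_self,
    Finsupp.single_apply]

lemma ext_coeff {a b : FreeAlgebra R (Fin 2)} (h : ∀ w, coeff w a = coeff w b) : a = b :=
  (wordBasis R).ext_elem h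

lemma linearMap_ext_monom {M : Type*} [AddCommGroup M] [Module R M]
    {f g : FreeAlgebra R (Fin 2) →ₗ[R] M} (h : ∀ w, f (monom R w) = g (monom R w)) : f = g :=
  (wordBasis R).ext fun w => by simpa using h w

lemma coeff_cons_ι_mul (t : Fin 2) (w : List (Fin 2)) (s : Fin 2) (a : FreeAlgebra R (Fin 2)) :
    coeff (t :: w) (FreeAlgebra.ι R s * a) = if s = t then coeff w a else 0 := by
  have h : (coeff (t :: w)) ∘ₗ LinearMap.mulLeft R (FreeAlgebra.ι R s) =
      (if s = t then (1 : R) else 0) • coeff w := by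
    refine linearMap_ext_monom fun v => ?_
    simp only [LinearMap.comp_apply, LinearMap.mulLeft_apply, ← monom_cons, coeff_monom,
      LinearMap.smul_apply, List.cons.injEq]
    by_cases h : s = t <;> simp [h]
  have := LinearMap.congr_fun h a
  split_ifs at this ⊢ <;> simpa using this

lemma coeff_nil_ι_mul (s : Fin 2) (a : FreeAlgebra R (Fin 2)) :
    coeff [] (FreeAlgebra.ι R s * a) = 0 := by
  have h : (coeff []) ∘ₗ LinearMap.mulLeft R (FreeAlgebra.ι R s) = 0 := by
    refine linearMap_ext_monom fun v => ?_
    simp [← monom_cons, coeff_monom]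
  simpa using LinearMap.congr_fun h a

lemma coeff_concat_mul_ι (t : Fin 2) (w : List (Fin 2)) (s : Fin 2) (a : FreeAlgebra R (Fin 2)) :
    coeff (w ++ [t]) (a * FreeAlgebra.ι R s) = if s = t then coeff w a else 0 := by
  have h : (coeff (w ++ [t])) ∘ₗ LinearMap.mulRight R (FreeAlgebra.ι R s) =
      (if s = t then (1 : R) else 0) • coeff w := by
    refine linearMap_ext_monom fun v => ?_
    have hv : monom R v * FreeAlgebra.ι R s = monom R (v ++ [s]) := by simp [monom_append]
    simp only [LinearMap.comp_apply, LinearMap.mulRight_apply, hv, coeff_monom,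
      LinearMap.smul_apply]
    by_cases h : s = t <;> simp [h]
  have := LinearMap.congr_fun h a
  split_ifs at this ⊢ <;> simpa using this

lemma coeff_nil_mul_ι (s : Fin 2) (a : FreeAlgebra R (Fin 2)) :
    coeff [] (a * FreeAlgebra.ι R s) = 0 := by
  have h : (coeff []) ∘ₗ LinearMap.mulRight R (FreeAlgebra.ι R s) = 0 := by
    refine linearMap_ext_monom fun v => ?_
    have hv : monom R v * FreeAlgebra.ι R s = monom R (v ++ [s]) := by simp [monom_append]
    simp [hv, coeff_monom]
  simpa using LinearMap.congr_fun h a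

lemma span_ι_pow_eq (k : ℕ) :
    Submodule.span R (Set.range (FreeAlgebra.ι R : Fin 2 → _)) ^ k =
      Submodule.span R (monom R '' {w | w.length = k}) := by
  induction k with
  | zero =>
    have : {w : List (Fin 2) | w.length = 0} = {[]} := by ext; simp
    rw [this, pow_zero, Set.image_singleton, monom_nil, Submodule.one_eq_span]
  | succ k ih =>
    rw [pow_succ', ih, Submodule.span_mul_span]
    congr 1
    ext x
    simp only [Set.mem_mul, Set.mem_range, Set.mem_image, Set.mem_ofPred_eq]
    constructor
    · rintro ⟨_, ⟨s, rfl⟩, _, ⟨w, hw, rfl⟩, rfl⟩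
      exact ⟨s :: w, by simp [hw], by simp⟩
    · rintro ⟨w, hw, rfl⟩
      cases w with
      | nil => simp at hw
      | cons s w => exact ⟨_, ⟨s, rfl⟩, _, ⟨w, by simpa using hw, rfl⟩, by simp⟩

lemma mem_span_ι_pow {k : ℕ} {a : FreeAlgebra R (Fin 2)} :
    a ∈ Submodule.span R (Set.range (FreeAlgebra.ι R : Fin 2 → _)) ^ k ↔
      ∀ w : List (Fin 2), w.length ≠ k → coeff w a = 0 := by
  rw [span_ι_pow_eq]
  have : monom R '' {w | w.length = k} = wordBasis R '' {w | w.length = k} := by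
    simp [Set.image]
  rw [this, Module.Basis.mem_span_image]
  constructor
  · intro h w hw
    by_contra h0
    exact hw (h (by simpa [coeff] using h0))
  · intro h w hw
    by_contra h0
    exact (by simpa using hw : (wordBasis R).repr a w ≠ 0) (h w h0)

end Words

/-! ### Weighted Dynkin operators and the Dynkin–Specht–Wever identity. -/

section Theta

variable {R : Type*} [CommRing R] (δ : Fin 2 → R)

/-- The right-normed bracketing of a word, weighted by `δ` of the last letter. -/
def thetaWord : List (Fin 2) → FreeAlgebra R (Fin 2)
  | [] => 0
  | [s] => δ s • FreeAlgebra.ι R s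
  | s :: t :: w => ⁅FreeAlgebra.ι R s, thetaWord (t :: w)⁆

/-- The weighted Dynkin operator. -/
def theta : FreeAlgebra R (Fin 2) →ₗ[R] FreeAlgebra R (Fin 2) :=
  (wordBasis R).constr R (thetaWord δ)

@[simp] lemma theta_monom (w : List (Fin 2)) : theta δ (monom R w) = thetaWord δ w := by
  rw [← wordBasis_apply, theta, Module.Basis.constr_basis]

/-- The recursive bracketing rule holds on all nonempty words; the constant term of `a` needs a
correction, because a one-letter word gets its weight instead of a bracket. -/
lemma theta_ι_mul (s : Fin 2) (a : FreeAlgebra R (Fin 2)) :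
    theta δ (FreeAlgebra.ι R s * a) =
      ⁅FreeAlgebra.ι R s, theta δ a⁆ + (coeff [] a * δ s) • FreeAlgebra.ι R s := by
  have h : theta δ ∘ₗ LinearMap.mulLeft R (FreeAlgebra.ι R s) =
      (LieAlgebra.ad R _ (FreeAlgebra.ι R s) : _ →ₗ[R] _) ∘ₗ theta δ +
        (coeff []).smulRight (δ s • FreeAlgebra.ι R s) := by
    refine linearMap_ext_monom fun v => ?_
    cases v with
    | nil =>
      have : FreeAlgebra.ι R s = monom R [s] := by simp
      simp [coeff_monom, -monom_nil]
      rw [monom_nil, mul_one, this, theta_monom]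
      simp [thetaWord]
    | cons t v =>
      simp only [LinearMap.comp_apply, LinearMap.mulLeft_apply, LinearMap.add_apply]
      rw [← monom_cons R s]
      simp [-monom_cons, thetaWord, coeff_monom]
  have := LinearMap.congr_fun h a
  simpa [smul_smul] using this

/-- The derivation multiplying a word by its `δ`-weight. -/
def euler : FreeAlgebra R (Fin 2) →ₗ[R] FreeAlgebra R (Fin 2) :=
  (wordBasis R).constr R fun w => (w.map δ).sum • monom R w

@[simp] lemma euler_monom (w : List (Fin 2)) :
    euler δ (monom R w) = (w.map δ).sum • monom R w := by
  conv_lhs => rw [← wordBasis_apply, euler, Module.Basis.constr_basis]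

lemma euler_mul (a b : FreeAlgebra R (Fin 2)) :
    euler δ (a * b) = euler δ a * b + a * euler δ b := by
  have h : (LinearMap.mul R (FreeAlgebra R (Fin 2))).compr₂ (euler δ) =
      (LinearMap.mul R (FreeAlgebra R (Fin 2))).comp (euler δ) +
        (LinearMap.mul R (FreeAlgebra R (Fin 2))).compl₂ (euler δ) := by
    refine linearMap_ext_monom fun v => linearMap_ext_monom fun w => ?_
    simp [← monom_append, add_smul]
  simpa using LinearMap.congr_fun₂ h a b

lemma coeff_euler (w : List (Fin 2)) (a : FreeAlgebra R (Fin 2)) :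
    coeff w (euler δ a) = (w.map δ).sum * coeff w a := by
  have h : coeff w ∘ₗ euler δ = (w.map δ).sum • coeff w := by
    refine linearMap_ext_monom fun v => ?_
    simp only [LinearMap.comp_apply, euler_monom, map_smul, coeff_monom, LinearMap.smul_apply]
    split_ifs with h
    · rw [h]
    · simp
  simpa using LinearMap.congr_fun h a

variable (R) in
/-- The free Lie algebra over a commutative ring, inside the free associative algebra. -/
abbrev lieElements : LieSubalgebra R (FreeAlgebra R (Fin 2)) :=
  LieSubalgebra.lieSpan R (FreeAlgebra R (Fin 2)) (Set.range (FreeAlgebra.ι R))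

lemma coeff_nil_mul (a b : FreeAlgebra R (Fin 2)) :
    coeff [] (a * b) = coeff [] a * coeff [] b := by
  have h : (LinearMap.mul R (FreeAlgebra R (Fin 2))).compr₂ (coeff []) =
      (LinearMap.mul R R).compl₁₂ (coeff []) (coeff []) := by
    refine linearMap_ext_monom fun v => linearMap_ext_monom fun w => ?_
    cases v <;> cases w <;> simp [← monom_append, coeff_monom, -monom_cons, -monom_nil]
  simpa using LinearMap.congr_fun₂ h a b

/-- The three claims must be proved in one induction over brackets: θ(xy - yx) = [x, θy] - [y, θx]
by the second claim, which needs the vanishing constant terms; the third claim turns this into the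
Leibniz rule for the Euler derivation. -/
lemma lieElements_aux {x : FreeAlgebra R (Fin 2)} (hx : x ∈ lieElements R) :
    coeff [] x = 0 ∧ (∀ y, coeff [] y = 0 → theta δ (x * y) = ⁅x, theta δ y⁆) ∧
      theta δ x = euler δ x := by
  have hmul : ∀ a b : FreeAlgebra R (Fin 2), coeff [] b = 0 → coeff [] (a * b) = 0 := by
    intro a b hb
    rw [coeff_nil_mul, hb, mul_zero]
  induction hx using LieSubalgebra.lieSpan_induction with
  | mem x hx =>
    obtain ⟨s, rfl⟩ := hx
    refine ⟨?_, fun y hy => ?_, ?_⟩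
    · simpa using coeff_nil_ι_mul (R := R) s 1
    · rw [theta_ι_mul, hy]; simp
    · have : FreeAlgebra.ι R s = monom R [s] := by simp
      rw [this, theta_monom, euler_monom]
      simp [thetaWord]
  | zero => simp
  | add x y _ _ hx hy =>
    refine ⟨by simp [hx.1, hy.1], fun z hz => ?_, by simp [hx.2.2, hy.2.2]⟩
    rw [add_mul, map_add, hx.2.1 z hz, hy.2.1 z hz, add_lie]
  | smul r x _ hx =>
    refine ⟨by simp [hx.1], fun z hz => ?_, by simp [hx.2.2]⟩
    rw [smul_mul_assoc, map_smul, hx.2.1 z hz, smul_lie]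
  | lie x y _ _ hx hy =>
    refine ⟨?_, fun z hz => ?_, ?_⟩
    · rw [LieRing.of_associative_ring_bracket, map_sub, coeff_nil_mul, coeff_nil_mul, mul_comm,
        sub_self]
    · rw [LieRing.of_associative_ring_bracket, sub_mul, map_sub, mul_assoc, mul_assoc,
        hx.2.1 _ (hmul _ _ hz), hy.2.1 _ (hmul _ _ hz), hx.2.1 _ hz, hy.2.1 _ hz,
        ← LieRing.of_associative_ring_bracket, lie_lie]
    · rw [LieRing.of_associative_ring_bracket, map_sub, map_sub, hx.2.1 _ hy.1, hy.2.1 _ hx.1,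
        hx.2.2, hy.2.2, euler_mul, euler_mul]
      simp only [LieRing.of_associative_ring_bracket]
      abel

lemma theta_eq_euler {x : FreeAlgebra R (Fin 2)} (hx : x ∈ lieElements R) :
    theta δ x = euler δ x := (lieElements_aux δ hx).2.2

lemma thetaWord_mem : ∀ w : List (Fin 2), thetaWord δ w ∈ lieElements R
  | [] => zero_mem _
  | [s] => (lieElements R).smul_mem _ (LieSubalgebra.subset_lieSpan (Set.mem_range_self s))
  | s :: t :: w => (lieElements R).lie_mem (LieSubalgebra.subset_lieSpan (Set.mem_range_self s))
      (thetaWord_mem (t :: w))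

end Theta

/-! ### Chains [X₁,u] = [X₂,v], [X₁,v] = [X₂,w] and symmetric coefficients. -/

section Chain

variable {R : Type*} [CommRing R]

/-- The words of length `k`. -/
def wordsOfLength (k : ℕ) : Finset (List (Fin 2)) :=
  (Finset.univ : Finset (Fin k → Fin 2)).image List.ofFn

@[simp] lemma mem_wordsOfLength {k : ℕ} {w : List (Fin 2)} :
    w ∈ wordsOfLength k ↔ w.length = k := by
  simp only [wordsOfLength, Finset.mem_image, Finset.mem_univ, true_and]
  exact ⟨fun ⟨v, hv⟩ => by simp [← hv], fun h => by subst h; exact ⟨w.get, List.ofFn_get w⟩⟩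

lemma eq_sum_append_pair {k : ℕ} {u : FreeAlgebra R (Fin 2)}
    (hu : ∀ w : List (Fin 2), w.length ≠ k + 2 → coeff w u = 0) :
    u = ∑ l ∈ wordsOfLength k, ∑ x : Fin 2, ∑ y : Fin 2,
      coeff (l ++ [x, y]) u • monom R (l ++ [x, y]) := by
  refine ext_coeff fun v => ?_
  simp only [map_sum, map_smul, coeff_monom, smul_eq_mul]
  by_cases hv : v.length = k + 2
  · obtain ⟨l, x, y, rfl⟩ : ∃ l x y, v = l ++ [x, y] := by
      have h1 : v ≠ [] := by rintro rfl; simp at hv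
      have h2 : v.dropLast ≠ [] := by
        intro h; have := congrArg List.length h; simp at this; omega
      refine ⟨v.dropLast.dropLast, v.dropLast.getLast h2, v.getLast h1, ?_⟩
      conv_lhs => rw [← List.dropLast_append_getLast h1, ← List.dropLast_append_getLast h2]
      simp
    have hl : l.length = k := by simpa using hv
    rw [Finset.sum_eq_single_of_mem l (by simpa using hl), Finset.sum_eq_single_of_mem x (by simp),
      Finset.sum_eq_single_of_mem y (by simp)]
    · simp
    · intro b _ hb; simp [hb]
    · intro b _ hb; simp [hb]
    · intro b hb hne
      refine Finset.sum_eq_zero fun x' _ => Finset.sum_eq_zero fun y' _ => ?_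
      rw [if_neg, mul_zero]
      intro h
      exact hne (List.append_inj_left' h (by simp))
  · rw [hu v hv]
    symm
    refine Finset.sum_eq_zero fun l hl => Finset.sum_eq_zero fun x _ =>
      Finset.sum_eq_zero fun y _ => ?_
    rw [if_neg, mul_zero]
    rintro rfl
    simp at hl hv
    exact hv hl

lemma thetaWord_cons (δ : Fin 2 → R) (s : Fin 2) {w : List (Fin 2)} (hw : w ≠ []) :
    thetaWord δ (s :: w) = ⁅FreeAlgebra.ι R s, thetaWord δ w⁆ := by
  cases w with
  | nil => exact absurd rfl hw
  | cons t w => rfl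

lemma thetaWord_append_swap (l : List (Fin 2)) (x y : Fin 2) :
    thetaWord (1 : Fin 2 → R) (l ++ [y, x]) = -thetaWord 1 (l ++ [x, y]) := by
  induction l with
  | nil => simp [thetaWord]
  | cons s l ih =>
    rw [List.cons_append, List.cons_append, thetaWord_cons _ _ (by simp),
      thetaWord_cons _ _ (by simp), ih, lie_neg]

lemma thetaWord_append_self (l : List (Fin 2)) (x : Fin 2) :
    thetaWord (1 : Fin 2 → R) (l ++ [x, x]) = 0 := by
  induction l with
  | nil => simp [thetaWord]
  | cons s l ih =>
    rw [List.cons_append, thetaWord_cons _ _ (by simp), ih, lie_zero]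

/-- With all weights equal to 1 the innermost bracket of the right-normed bracketing is
antisymmetric in the last two letters, so symmetric coefficients cancel in pairs. -/
lemma theta_eq_zero_of_symm {k : ℕ} {u : FreeAlgebra R (Fin 2)}
    (hu : ∀ w : List (Fin 2), w.length ≠ k + 2 → coeff w u = 0)
    (hs : ∀ l x y, coeff (l ++ [x, y]) u = coeff (l ++ [y, x]) u) :
    theta 1 u = 0 := by
  rw [eq_sum_append_pair hu]
  simp only [map_sum, map_smul, theta_monom]
  refine Finset.sum_eq_zero fun l _ => ?_
  simp only [Fin.sum_univ_two, thetaWord_append_self, hs l 1 0, thetaWord_append_swap l 0 1]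
  simp

/-- A homogeneous Lie element whose coefficients are symmetric in the last two letters vanishes,
if its degree is invertible. -/
lemma eq_zero_of_symm [NoZeroDivisors R] {k : ℕ} {u : FreeAlgebra R (Fin 2)}
    (hL : u ∈ lieElements R)
    (hk : ((k + 2 : ℕ) : R) ≠ 0)
    (hu : ∀ w : List (Fin 2), w.length ≠ k + 2 → coeff w u = 0)
    (hs : ∀ l x y, coeff (l ++ [x, y]) u = coeff (l ++ [y, x]) u) : u = 0 := by
  have h0 := theta_eq_zero_of_symm hu hs
  rw [theta_eq_euler 1 hL] at h0
  refine ext_coeff fun w => ?_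
  by_cases hw : w.length = k + 2
  · have h1 := congrArg (coeff w) h0
    rw [coeff_euler] at h1
    have : (w.map (1 : Fin 2 → R)).sum = ((k + 2 : ℕ) : R) := by
      rw [← hw]; simp [Pi.one_def]
    rw [this, map_zero] at h1
    rw [map_zero]
    exact (mul_eq_zero.1 h1).resolve_left hk
  · rw [hu w hw, map_zero]

/-- Rewriting the equation as X₀u - X₁v = uX₀ - vX₁, with the letters indexed by `Fin 2`, and
comparing coefficients of the word alb lets a letter move from one end of a word to the other. -/
lemma coeff_rotate {u v : FreeAlgebra R (Fin 2)}
    (h : ⁅FreeAlgebra.ι R (0 : Fin 2), u⁆ = ⁅FreeAlgebra.ι R (1 : Fin 2), v⁆)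
    (l : List (Fin 2)) (a b : Fin 2) :
    (if a = 0 then coeff (l ++ [b]) u else -coeff (l ++ [b]) v) =
      if b = 0 then coeff (a :: l) u else -coeff (a :: l) v := by
  have h1 : FreeAlgebra.ι R (0 : Fin 2) * u - FreeAlgebra.ι R (1 : Fin 2) * v =
      u * FreeAlgebra.ι R (0 : Fin 2) - v * FreeAlgebra.ι R (1 : Fin 2) := by
    simp only [LieRing.of_associative_ring_bracket] at h
    rw [sub_eq_sub_iff_add_eq_add] at h ⊢
    rw [h, add_comm]
  have h2 := congrArg (coeff (a :: (l ++ [b]))) h1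
  rw [map_sub, map_sub, coeff_cons_ι_mul, coeff_cons_ι_mul, ← List.cons_append,
    coeff_concat_mul_ι, coeff_concat_mul_ι] at h2
  fin_cases a <;> fin_cases b <;> simpa using h2

/-- If `[X_0, u] = [X_1, v]` and `[X_0, v] = [X_1, w]`, then the coefficients of `u` and `w` are
symmetric in the last two letters. -/
lemma coeff_symm_of_chain {u v w : FreeAlgebra R (Fin 2)}
    (h₁ : ⁅FreeAlgebra.ι R (0 : Fin 2), u⁆ = ⁅FreeAlgebra.ι R (1 : Fin 2), v⁆)
    (h₂ : ⁅FreeAlgebra.ι R (0 : Fin 2), v⁆ = ⁅FreeAlgebra.ι R (1 : Fin 2), w⁆)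
    (l : List (Fin 2)) (a b : Fin 2) :
    coeff (l ++ [a, b]) u = coeff (l ++ [b, a]) u ∧
      coeff (l ++ [a, b]) w = coeff (l ++ [b, a]) w := by
  -- The elements u, -v, w are arranged as a symmetric 2 × 2 array, so that both equations become
  -- the single rotation rule `hrot`.
  let g : Fin 2 → Fin 2 → List (Fin 2) → R := fun x y l =>
    if x = 0 then if y = 0 then coeff l u else -coeff l v
    else if y = 0 then -coeff l v else coeff l w
  have hswap : ∀ x y l, g x y l = g y x l := by
    intro x y l
    fin_cases x <;> fin_cases y <;> simp [g]
  have hrot : ∀ x a b l, g x a (l ++ [b]) = g x b (a :: l) := by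
    intro x a b l
    have e₁ := coeff_rotate h₁ l a b
    have e₂ := coeff_rotate h₂ l a b
    fin_cases x
    · simpa [g] using e₁
    · have := congrArg Neg.neg e₂
      fin_cases a <;> fin_cases b <;> simpa [g] using this
  -- The letters a and b are rotated into the two index slots, exchanged there by symmetry of the
  -- array, and rotated back in the opposite order.
  have key : ∀ x y, g x y (l ++ [a] ++ [b]) = g x y (l ++ [b] ++ [a]) := by
    intro x y
    calc g x y (l ++ [a] ++ [b]) = g x b ((y :: l) ++ [a]) := hrot ..
      _ = g a x (b :: y :: l) := by rw [hrot, hswap]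
      _ = g a b ((y :: l) ++ [x]) := (hrot ..).symm
      _ = g b x (a :: y :: l) := by rw [hswap, hrot]
      _ = g x a ((y :: l) ++ [b]) := by rw [hswap, hrot]
      _ = g x y (l ++ [b] ++ [a]) := (hrot ..).symm
  exact ⟨by simpa [g] using key 0 0, by simpa [g] using key 1 1⟩

/-- This makes the Dynkin matrix modulo p the reduction of one integer matrix, so that its ranks for
different primes can be compared. -/
lemma coeff_thetaWord_intCast (δ : Fin 2 → ℤ) : ∀ w v : List (Fin 2),
    coeff v (thetaWord (fun s => (δ s : R)) w) = ((coeff v (thetaWord δ w) : ℤ) : R)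
  | [], v => by simp [thetaWord]
  | [s], v => by
    have h : FreeAlgebra.ι R s = monom R [s] := by simp
    have h' : FreeAlgebra.ι ℤ s = monom ℤ [s] := by simp
    simp only [thetaWord, map_smul, h, h', coeff_monom]
    split_ifs <;> simp
  | s :: t :: w, v => by
    have ih := coeff_thetaWord_intCast δ (t :: w)
    simp only [thetaWord, LieRing.of_associative_ring_bracket, map_sub, Int.cast_sub]
    congr 1
    · cases v with
      | nil => simp [coeff_nil_ι_mul]
      | cons x v =>
        rw [coeff_cons_ι_mul, coeff_cons_ι_mul]
        split_ifs <;> simp [ih]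
    · cases v using List.reverseRecOn with
      | nil => simp [coeff_nil_mul_ι]
      | append_singleton v x =>
        rw [coeff_concat_mul_ι, coeff_concat_mul_ι]
        split_ifs <;> simp [ih]

end Chain

/-! ### Grading and lower central series of the free Lie algebra. -/

section FreeLie

variable {p : ℕ}

lemma mem_freeLieComp {k : ℕ} {x : freeLie p} :
    x ∈ freeLieComp p k ↔
      ∀ w : List (Fin 2), w.length ≠ k → coeff w (x : FreeAlgebra (ZMod p) (Fin 2)) = 0 :=
  mem_span_ι_pow

lemma coe_lie_freeGen (i : Fin 2) (x : freeLie p) :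
    ((⁅freeGen p i, x⁆ : freeLie p) : FreeAlgebra (ZMod p) (Fin 2)) =
      FreeAlgebra.ι (ZMod p) i * x - x * FreeAlgebra.ι (ZMod p) i := by
  rw [LieSubalgebra.coe_bracket, LieRing.of_associative_ring_bracket]
  rfl

lemma coeff_nil_freeLie (x : freeLie p) :
    coeff [] (x : FreeAlgebra (ZMod p) (Fin 2)) = 0 := (lieElements_aux 0 x.2).1

lemma freeGen_mem (i : Fin 2) : freeGen p i ∈ freeLieComp p 1 := by
  show FreeAlgebra.ι (ZMod p) i ∈ words p 1
  rw [words, pow_one]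
  exact Submodule.subset_span (Set.mem_range_self i)

lemma lie_freeGen_mem {k : ℕ} (i : Fin 2) {x : freeLie p} (hx : x ∈ freeLieComp p k) :
    ⁅freeGen p i, x⁆ ∈ freeLieComp p (k + 1) := by
  have hι : FreeAlgebra.ι (ZMod p) i ∈
      Submodule.span (ZMod p) (Set.range (FreeAlgebra.ι (ZMod p) : Fin 2 → _)) :=
    Submodule.subset_span (Set.mem_range_self i)
  show ((⁅freeGen p i, x⁆ : freeLie p) : FreeAlgebra (ZMod p) (Fin 2)) ∈ words p (k + 1)
  rw [coe_lie_freeGen, words]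
  refine sub_mem ?_ ?_
  · rw [pow_succ']; exact Submodule.mul_mem_mul hι hx
  · rw [pow_succ]; exact Submodule.mul_mem_mul hx hι

lemma eq_top_of_freeGen_mem {K : LieSubalgebra (ZMod p) (freeLie p)}
    (h : ∀ i, freeGen p i ∈ K) : K = ⊤ := by
  have key : ∀ (x : FreeAlgebra (ZMod p) (Fin 2)) (hx : x ∈ freeLie p),
      (⟨x, hx⟩ : freeLie p) ∈ K := by
    intro x hx
    induction hx using LieSubalgebra.lieSpan_induction with
    | mem x hx => obtain ⟨s, rfl⟩ := hx; exact h s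
    | zero => exact K.zero_mem
    | add x y _ _ hx hy => exact K.add_mem hx hy
    | smul r x _ hx => exact K.smul_mem r hx
    | lie x y _ _ hx hy => exact K.lie_mem hx hy
  rw [eq_top_iff]
  exact fun x _ => key x.1 x.2

/-- The span of the right-normed brackets of `j + 1` letters. -/
def rightNormed (p : ℕ) : ℕ → Submodule (ZMod p) (freeLie p)
  | 0 => Submodule.span (ZMod p) (Set.range (freeGen p))
  | j + 1 => ⨆ i : Fin 2, (rightNormed p j).map
      (LieAlgebra.ad (ZMod p) (freeLie p) (freeGen p i) : freeLie p →ₗ[ZMod p] freeLie p)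

lemma rightNormed_le : ∀ j : ℕ, rightNormed p j ≤ freeLieComp p (j + 1)
  | 0 => by
    rw [rightNormed, Submodule.span_le]
    rintro _ ⟨i, rfl⟩
    exact freeGen_mem i
  | j + 1 => by
    rw [rightNormed]
    refine iSup_le fun i => ?_
    rintro _ ⟨x, hx, rfl⟩
    exact lie_freeGen_mem i (rightNormed_le j hx)

lemma lie_freeGen_mem_rightNormed {j : ℕ} (i : Fin 2) {x : freeLie p} (hx : x ∈ rightNormed p j) :
    ⁅freeGen p i, x⁆ ∈ rightNormed p (j + 1) := by
  rw [rightNormed]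
  exact Submodule.mem_iSup_of_mem i ⟨x, hx, rfl⟩

/-- The elements whose bracket preserves a given submodule. -/
def stabilizerSubalgebra {L : Type*} [LieRing L] [LieAlgebra (ZMod p) L]
    (φ : freeLie p →ₗ⁅ZMod p⁆ L) (N : Submodule (ZMod p) L) :
    LieSubalgebra (ZMod p) (freeLie p) where
  carrier := {x | ∀ y ∈ N, ⁅φ x, y⁆ ∈ N}
  add_mem' ha hb y hy := by rw [map_add, add_lie]; exact add_mem (ha y hy) (hb y hy)
  zero_mem' y _ := by rw [map_zero, zero_lie]; exact zero_mem _
  smul_mem' r x hx y hy := by rw [map_smul, smul_lie]; exact N.smul_mem r (hx y hy)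
  lie_mem' {a b} ha hb y hy := by
    rw [LieHom.map_lie, lie_lie]
    exact sub_mem (ha _ (hb y hy)) (hb _ (ha y hy))

lemma lie_mem_of_freeGen {L : Type*} [LieRing L] [LieAlgebra (ZMod p) L]
    (φ : freeLie p →ₗ⁅ZMod p⁆ L) (N : Submodule (ZMod p) L)
    (h : ∀ i, ∀ y ∈ N, ⁅φ (freeGen p i), y⁆ ∈ N) (x : freeLie p) {y : L} (hy : y ∈ N) :
    ⁅φ x, y⁆ ∈ N := by
  have := eq_top_of_freeGen_mem (K := stabilizerSubalgebra φ N) h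
  have hx : x ∈ stabilizerSubalgebra φ N := by rw [this]; trivial
  exact hx y hy

/-- The span is stable under bracketing with letters, hence with every element, because stabilizers
are subalgebras. It is therefore itself a subalgebra containing the letters. -/
lemma iSup_rightNormed : ⨆ j, rightNormed p j = ⊤ := by
  set N := ⨆ j, rightNormed p j with hN
  have h : ∀ i, ∀ y ∈ N, ⁅freeGen p i, y⁆ ∈ N := by
    intro i y hy
    induction hy using Submodule.iSup_induction' with
    | mem j x hx => exact Submodule.mem_iSup_of_mem (j + 1) (lie_freeGen_mem_rightNormed i hx)
    | zero => rw [lie_zero]; exact zero_mem _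
    | add x y _ _ hx hy => rw [lie_add]; exact add_mem hx hy
  let K : LieSubalgebra (ZMod p) (freeLie p) :=
    { N with lie_mem' := fun {x y} _ hy => lie_mem_of_freeGen LieHom.id N h x hy }
  have hK : K = ⊤ := eq_top_of_freeGen_mem fun i =>
    Submodule.mem_iSup_of_mem (p := rightNormed p) 0
      (by rw [rightNormed]; exact Submodule.subset_span (Set.mem_range_self i))
  rw [eq_top_iff]
  intro x _
  have : x ∈ K := by rw [hK]; trivial
  exact this

lemma freeLieComp_zero : freeLieComp p 0 = ⊥ := by
  rw [eq_bot_iff]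
  intro x hx
  rw [mem_freeLieComp] at hx
  rw [Submodule.mem_bot]
  refine Subtype.ext (ext_coeff fun w => ?_)
  cases w with
  | nil => simpa using coeff_nil_freeLie x
  | cons s w => simpa using hx (s :: w) (by simp)

/-- Each right-normed span is homogeneous and together they exhaust the algebra, so the degree j+1
part of any Lie polynomial comes from the j-th span alone. -/
lemma rightNormed_eq (j : ℕ) : rightNormed p j = freeLieComp p (j + 1) := by
  refine le_antisymm (rightNormed_le j) ?_
  have key : ∀ x : freeLie p, ∃ y ∈ rightNormed p j, ∀ w : List (Fin 2), w.length = j + 1 →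
      coeff w (x : FreeAlgebra (ZMod p) (Fin 2)) =
        coeff w (y : FreeAlgebra (ZMod p) (Fin 2)) := by
    intro x
    have hx : x ∈ ⨆ j, rightNormed p j := by rw [iSup_rightNormed]; trivial
    induction hx using Submodule.iSup_induction' with
    | mem i x hx =>
      by_cases hij : i = j
      · subst hij; exact ⟨x, hx, fun _ _ => rfl⟩
      · refine ⟨0, zero_mem _, fun w hw => ?_⟩
        rw [mem_freeLieComp.1 (rightNormed_le i hx) w (by omega)]
        simp
    | zero => exact ⟨0, zero_mem _, fun _ _ => rfl⟩
    | add x x' _ _ hx hx' =>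
      obtain ⟨y, hy, h⟩ := hx
      obtain ⟨y', hy', h'⟩ := hx'
      refine ⟨y + y', add_mem hy hy', fun w hw => ?_⟩
      simp [h w hw, h' w hw]
  intro x hx
  obtain ⟨y, hy, h⟩ := key x
  have : x = y := by
    refine Subtype.ext (ext_coeff fun w => ?_)
    by_cases hw : w.length = j + 1
    · exact h w hw
    · rw [mem_freeLieComp.1 hx w hw, mem_freeLieComp.1 (rightNormed_le j hy) w hw]
  rwa [this]

lemma freeLieComp_succ (j : ℕ) : freeLieComp p (j + 2) =
    ⨆ i : Fin 2, (freeLieComp p (j + 1)).map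
      (LieAlgebra.ad (ZMod p) (freeLie p) (freeGen p i) : freeLie p →ₗ[ZMod p] freeLie p) := by
  rw [← rightNormed_eq, ← rightNormed_eq, rightNormed]

lemma rightNormed_fg : ∀ j : ℕ, (rightNormed p j).FG
  | 0 => Submodule.fg_span (Set.finite_range _)
  | j + 1 => Submodule.fg_iSup _ fun _ => (rightNormed_fg j).map _

lemma freeLieComp_fg (k : ℕ) : (freeLieComp p k).FG := by
  cases k with
  | zero => rw [freeLieComp_zero]; exact Submodule.fg_bot
  | succ j => rw [← rightNormed_eq]; exact rightNormed_fg j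

lemma iSup_freeLieComp : ⨆ k, freeLieComp p k = ⊤ := by
  rw [eq_top_iff, ← iSup_rightNormed]
  exact iSup_le fun j => (rightNormed_eq j).le.trans (le_iSup _ _)

lemma rightNormed_le_lowerCentralSeries : ∀ (j : ℕ) {x : freeLie p}, x ∈ rightNormed p j →
    x ∈ LieModule.lowerCentralSeries (ZMod p) (freeLie p) (freeLie p) j
  | 0, x, _ => by simp
  | j + 1, x, hx => by
    suffices rightNormed p (j + 1) ≤
        (LieModule.lowerCentralSeries (ZMod p) (freeLie p) (freeLie p) (j + 1)).toSubmodule from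
      this hx
    rw [rightNormed, LieModule.lowerCentralSeries_succ]
    refine iSup_le fun i => ?_
    rintro _ ⟨y, hy, rfl⟩
    exact LieSubmodule.lie_mem_lie (by simp) (rightNormed_le_lowerCentralSeries j hy)

/-- Lie polynomials without terms of degree less than `j`. -/
def highDegree (p j : ℕ) : Submodule (ZMod p) (freeLie p) where
  carrier := {x | ∀ w : List (Fin 2), w.length < j →
    coeff w (x : FreeAlgebra (ZMod p) (Fin 2)) = 0}
  add_mem' ha hb w hw := by simp [ha w hw, hb w hw]
  zero_mem' w _ := by simp
  smul_mem' r x hx w hw := by simp [hx w hw]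

lemma lie_mem_highDegree {j : ℕ} (x : freeLie p) {y : freeLie p} (hy : y ∈ highDegree p j) :
    ⁅x, y⁆ ∈ highDegree p (j + 1) := by
  have hmono : highDegree p (j + 1) ≤ highDegree p j := fun x hx w hw => hx w (by omega)
  let K : LieSubalgebra (ZMod p) (freeLie p) :=
    { carrier := {x | ∀ y ∈ highDegree p j, ⁅x, y⁆ ∈ highDegree p (j + 1)}
      add_mem' := fun ha hb y hy => by rw [add_lie]; exact add_mem (ha y hy) (hb y hy)
      zero_mem' := fun y _ => by rw [zero_lie]; exact zero_mem _
      smul_mem' := fun r x hx y hy => by rw [smul_lie]; exact Submodule.smul_mem _ r (hx y hy)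
      lie_mem' := fun {a b} ha hb y hy => by
        rw [lie_lie]
        exact sub_mem (ha _ (hmono (hb y hy))) (hb _ (hmono (ha y hy))) }
  have hK : K = ⊤ := by
    refine eq_top_of_freeGen_mem fun i y hy w hw => ?_
    rw [coe_lie_freeGen, map_sub]
    have h1 : coeff w (FreeAlgebra.ι (ZMod p) i * (y : FreeAlgebra (ZMod p) (Fin 2))) = 0 := by
      cases w with
      | nil => exact coeff_nil_ι_mul _ _
      | cons t w =>
        rw [coeff_cons_ι_mul, hy w (by simpa using hw), ite_self]
    have h2 : coeff w ((y : FreeAlgebra (ZMod p) (Fin 2)) * FreeAlgebra.ι (ZMod p) i) = 0 := by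
      cases w using List.reverseRecOn with
      | nil => exact coeff_nil_mul_ι _ _
      | append_singleton w t =>
        rw [coeff_concat_mul_ι, hy w (by simpa using hw), ite_self]
    rw [h1, h2, sub_zero]
  have hx : x ∈ K := by rw [hK]; trivial
  exact hx y hy

/-- Bracketing raises the lowest degree by at least one. Consequently passing to the class-c
quotient loses nothing in degrees up to c. -/
lemma lowerCentralSeries_le_highDegree : ∀ j : ℕ,
    (LieModule.lowerCentralSeries (ZMod p) (freeLie p) (freeLie p) j).toSubmodule ≤
      highDegree p (j + 1)
  | 0 => fun x _ w hw => by
    have : w = [] := by simpa using hw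
    subst this
    exact coeff_nil_freeLie x
  | j + 1 => by
    rw [LieModule.lowerCentralSeries_succ, LieSubmodule.lieIdeal_oper_eq_linear_span,
      Submodule.span_le]
    rintro _ ⟨x, y, rfl⟩
    exact lie_mem_highDegree _ (lowerCentralSeries_le_highDegree j y.2)

end FreeLie

/-! ### Graded structure of the nilpotent quotient and the chain condition. -/

section Nilpotent

variable {p c : ℕ}

lemma proj_surjective : Function.Surjective (proj p c) :=
  LieSubmodule.Quotient.surjective_mk' _

lemma proj_eq_zero_iff {x : freeLie p} : proj p c x = 0 ↔
    x ∈ LieModule.lowerCentralSeries (ZMod p) (freeLie p) (freeLie p) c :=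
  LieSubmodule.Quotient.mk_eq_zero _

lemma coeff_eq_zero_of_proj_eq_zero {x : freeLie p} (hx : proj p c x = 0) {w : List (Fin 2)}
    (hw : w.length ≤ c) : coeff w (x : FreeAlgebra (ZMod p) (Fin 2)) = 0 :=
  lowerCentralSeries_le_highDegree c (proj_eq_zero_iff.1 hx) w (by omega)

/-- The quotient map as a Lie algebra morphism. -/
def projLie (p c : ℕ) : freeLie p →ₗ⁅ZMod p⁆ FreeNilp p c :=
  { proj p c with map_lie' := fun {_ _} => LieSubmodule.Quotient.mk_bracket _ _ _ }

lemma phi_proj (i : Fin 2) (x : freeLie p) :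
    phi p c i (proj p c x) = proj p c ⁅freeGen p i, x⁆ :=
  (LieHom.map_lie (projLie p c) (freeGen p i) x).symm

lemma eq_of_proj_eq {k : ℕ} (hk : k ≤ c) {x y : freeLie p} (hx : x ∈ freeLieComp p k)
    (hy : y ∈ freeLieComp p k) (h : proj p c x = proj p c y) : x = y := by
  have h0 : proj p c (x - y) = 0 := by rw [map_sub, h, sub_self]
  refine Subtype.ext (ext_coeff fun w => ?_)
  by_cases hw : w.length = k
  · have := coeff_eq_zero_of_proj_eq_zero h0 (w := w) (by omega)
    rw [← sub_eq_zero]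
    simpa using this
  · rw [mem_freeLieComp.1 hx w hw, mem_freeLieComp.1 hy w hw]

lemma lieComp_eq_bot {k : ℕ} (hk : c < k) : lieComp p c k = ⊥ := by
  rw [lieComp, ← le_bot_iff, Submodule.map_le_iff_le_comap, Submodule.comap_bot]
  obtain ⟨j, rfl⟩ : ∃ j, k = j + 1 := ⟨k - 1, by omega⟩
  rw [← rightNormed_eq]
  intro x hx
  rw [LinearMap.mem_ker, proj_eq_zero_iff]
  exact LieModule.antitone_lowerCentralSeries (ZMod p) (freeLie p) (freeLie p) (by omega : c ≤ j)
    (rightNormed_le_lowerCentralSeries j hx)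

lemma iSup_lieComp : ⨆ k, lieComp p c k = ⊤ := by
  simp only [lieComp]
  rw [← Submodule.map_iSup, iSup_freeLieComp, Submodule.map_top, LinearMap.range_eq_top]
  exact proj_surjective

instance : Module.Finite (ZMod p) (FreeNilp p c) := by
  refine ⟨?_⟩
  have : (⊤ : Submodule (ZMod p) (FreeNilp p c)) =
      ⨆ k ∈ Finset.range (c + 1), lieComp p c k := by
    refine (eq_top_iff.2 ?_).symm
    rw [← iSup_lieComp]
    refine iSup_le fun k => ?_
    by_cases hk : c < k
    · rw [lieComp_eq_bot hk]; exact bot_le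
    · exact le_biSup (lieComp p c) (by simpa using by omega : k ∈ Finset.range (c + 1))
  rw [this]
  exact Submodule.fg_biSup _ _ fun k _ => (freeLieComp_fg k).map _

instance [Fact p.Prime] : Finite (FreeNilp p c) := Module.finite_of_finite (ZMod p)

lemma phi_mem {k : ℕ} (i : Fin 2) {x : FreeNilp p c} (hx : x ∈ lieComp p c k) :
    phi p c i x ∈ lieComp p c (k + 1) := by
  obtain ⟨y, hy, rfl⟩ := hx
  rw [phi_proj]
  exact ⟨_, lie_freeGen_mem i hy, rfl⟩

lemma lieComp_succ {k : ℕ} (hk : 1 ≤ k) : lieComp p c (k + 1) =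
    (lieComp p c k).map (phi p c 0) ⊔ (lieComp p c k).map (phi p c 1) := by
  obtain ⟨j, rfl⟩ : ∃ j, k = j + 1 := ⟨k - 1, by omega⟩
  have h : ∀ i, (lieComp p c (j + 1)).map (phi p c i) = ((freeLieComp p (j + 1)).map
      (LieAlgebra.ad (ZMod p) (freeLie p) (freeGen p i) : freeLie p →ₗ[ZMod p] freeLie p)).map
        (proj p c) := by
    intro i
    rw [lieComp, ← Submodule.map_comp, ← Submodule.map_comp]
    congr 1
  rw [h, h, lieComp, freeLieComp_succ, ← Submodule.map_sup]
  congr 1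
  refine le_antisymm (iSup_le fun i => ?_) (sup_le (le_iSup_of_le 0 le_rfl) (le_iSup_of_le 1 le_rfl))
  fin_cases i
  · exact le_sup_left
  · exact le_sup_right

/-- A submodule is an ideal as soon as it is stable under the two maps `phi`. -/
lemma lie_mem_of_phi_mem {S : Submodule (ZMod p) (FreeNilp p c)}
    (h : ∀ i, ∀ y ∈ S, phi p c i y ∈ S) (x : FreeNilp p c) {y : FreeNilp p c} (hy : y ∈ S) :
    ⁅x, y⁆ ∈ S := by
  obtain ⟨x, rfl⟩ := proj_surjective x
  exact lie_mem_of_freeGen (projLie p c) S h x hy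

/-- The sum of the homogeneous components of weight at least `k`. -/
def upper (p c k : ℕ) : Submodule (ZMod p) (FreeNilp p c) :=
  ⨆ j ∈ Set.Icc k c, lieComp p c j

lemma phi_upper_mem {k : ℕ} (i : Fin 2) {x : FreeNilp p c} (hx : x ∈ upper p c k) :
    phi p c i x ∈ upper p c k := by
  suffices upper p c k ≤ (upper p c k).comap (phi p c i) from this hx
  refine iSup₂_le fun j hj y hy => ?_
  rw [Submodule.mem_comap]
  by_cases hjc : j + 1 ≤ c
  · exact (le_biSup (lieComp p c) (⟨by have := hj.1; omega, hjc⟩ : j + 1 ∈ Set.Icc k c))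
      (phi_mem i hy)
  · have := phi_mem i hy
    rw [lieComp_eq_bot (by omega), Submodule.mem_bot] at this
    rw [this]
    exact zero_mem _

lemma exists_proj_of_mem_upper {k : ℕ} {x : FreeNilp p c} (hx : x ∈ upper p c k) :
    ∃ y : freeLie p, proj p c y = x ∧ y ∈ highDegree p k := by
  suffices upper p c k ≤ (highDegree p k).map (proj p c) by
    obtain ⟨y, hy, h⟩ := this hx
    exact ⟨y, h, hy⟩
  refine iSup₂_le fun j hj => Submodule.map_mono fun y hy w hw => ?_
  exact mem_freeLieComp.1 hy w (by have := hj.1; omega)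

/-- Uniqueness of the components of weights k and k+1: lifts to the free Lie algebra have equal
coefficients on all words of length at most c, and r contributes none of length k or k+1. -/
lemma eq_of_add_upper {k : ℕ} (hkc : k + 1 ≤ c) {x y a b r : FreeNilp p c}
    (hx : x ∈ lieComp p c k) (hy : y ∈ lieComp p c (k + 1)) (ha : a ∈ lieComp p c k)
    (hb : b ∈ lieComp p c (k + 1)) (hr : r ∈ upper p c (k + 2)) (h : x + y = a + b + r) :
    x = a ∧ y = b := by
  obtain ⟨x, hx, rfl⟩ := hx
  obtain ⟨y, hy, rfl⟩ := hy
  obtain ⟨a, ha, rfl⟩ := ha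
  obtain ⟨b, hb, rfl⟩ := hb
  obtain ⟨r, rfl, hr'⟩ := exists_proj_of_mem_upper hr
  have h0 : proj p c (x + y - (a + b + r)) = 0 := by simp [h]
  simp only [SetLike.mem_coe, mem_freeLieComp] at hx hy ha hb
  have h1 := fun (w : List (Fin 2)) hw => coeff_eq_zero_of_proj_eq_zero h0 (w := w) hw
  simp only [AddSubgroupClass.coe_sub, AddMemClass.coe_add, map_sub, map_add] at h1
  constructor
  · congr 1
    refine Subtype.ext (ext_coeff fun w => ?_)
    by_cases hw : w.length = k
    · have := h1 w (by omega)
      rw [hy w (by omega), hb w (by omega), hr' w (by omega)] at this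
      simpa [sub_eq_zero] using this
    · rw [hx w hw, ha w hw]
  · congr 1
    refine Subtype.ext (ext_coeff fun w => ?_)
    by_cases hw : w.length = k + 1
    · have := h1 w (by omega)
      rw [hx w (by omega), ha w (by omega), hr' w (by omega)] at this
      simpa [sub_eq_zero] using this
    · rw [hy w hw, hb w hw]

/-- The chain condition for the maps `phi` on a component of weight at least `2`. -/
lemma phi_chain [Fact p.Prime] (hp : c ≤ p) {k : ℕ} (hk : 2 ≤ k) (hkc : k + 1 ≤ c)
    {u v w : FreeNilp p c}
    (hu : u ∈ lieComp p c k) (hv : v ∈ lieComp p c k) (hw : w ∈ lieComp p c k)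
    (h₁ : phi p c 0 u = phi p c 1 v) (h₂ : phi p c 0 v = phi p c 1 w) : u = 0 ∧ w = 0 := by
  obtain ⟨u, hu, rfl⟩ := hu
  obtain ⟨v, hv, rfl⟩ := hv
  obtain ⟨w, hw, rfl⟩ := hw
  obtain ⟨j, rfl⟩ : ∃ j, k = j + 2 := ⟨k - 2, by omega⟩
  rw [phi_proj, phi_proj] at h₁ h₂
  have e₁ := eq_of_proj_eq hkc (lie_freeGen_mem 0 hu) (lie_freeGen_mem 1 hv) h₁
  have e₂ := eq_of_proj_eq hkc (lie_freeGen_mem 0 hv) (lie_freeGen_mem 1 hw) h₂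
  -- The weight j+2 is strictly below c ≤ p, hence not divisible by p.
  have hne : ((j + 2 : ℕ) : ZMod p) ≠ 0 := by
    rw [Ne, ZMod.natCast_eq_zero_iff]
    intro h
    have := Nat.le_of_dvd (by omega) h
    omega
  have hs := coeff_symm_of_chain (u := (u : FreeAlgebra (ZMod p) (Fin 2))) (v := v) (w := w)
    (congrArg Subtype.val e₁) (congrArg Subtype.val e₂)
  have hu0 : u = 0 := Subtype.ext
    (eq_zero_of_symm u.2 hne (mem_freeLieComp.1 hu) fun l a b => (hs l a b).1)
  have hw0 : w = 0 := Subtype.ext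
    (eq_zero_of_symm w.2 hne (mem_freeLieComp.1 hw) fun l a b => (hs l a b).2)
  rw [hu0, hw0, map_zero]
  exact ⟨rfl, rfl⟩

end Nilpotent

/-! ### Ranks of integer matrices modulo p. -/

section Rank

variable {m n : Type*} [Fintype m] [Fintype n] [DecidableEq m] [DecidableEq n]

/-- A certificate for rank at least r whose factors can be lifted to integer matrices. -/
lemma exists_mul_mul_eq_one {F : Type*} [Field F] (A : Matrix m n F) {r : ℕ} (hr : A.rank = r) :
    ∃ (B : Matrix (Fin r) m F) (C : Matrix n (Fin r) F), B * A * C = 1 := by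
  let b : Module.Basis (Fin r) F (LinearMap.range A.mulVecLin) :=
    Module.finBasisOfFinrankEq F _ hr
  choose x hx using fun i => (b i).2
  let C : (Fin r → F) →ₗ[F] (n → F) := Fintype.linearCombination F x
  have hinj : LinearMap.ker (A.mulVecLin ∘ₗ C) = ⊥ := by
    rw [LinearMap.ker_eq_bot']
    intro g hg
    have h0 : ∑ i, g i • b i = 0 := by
      apply Subtype.ext
      rw [LinearMap.comp_apply, Fintype.linearCombination_apply, map_sum] at hg
      simp only [map_smul, hx] at hg
      simpa using hg
    funext i
    exact Fintype.linearIndependent_iff.1 b.linearIndependent g h0 i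
  obtain ⟨g, hg⟩ := LinearMap.exists_leftInverse_of_injective _ hinj
  refine ⟨LinearMap.toMatrix' g, LinearMap.toMatrix' C, ?_⟩
  have h1 : A = LinearMap.toMatrix' A.mulVecLin := by
    rw [← Matrix.toLin'_apply', LinearMap.toMatrix'_toLin']
  rw [h1, ← LinearMap.toMatrix'_comp, ← LinearMap.toMatrix'_comp, LinearMap.comp_assoc, hg,
    LinearMap.toMatrix'_id]

omit [Fintype m] [DecidableEq m] [DecidableEq n] in
lemma rank_add_le {F : Type*} [Field F] (A B : Matrix m n F) :
    (A + B).rank ≤ A.rank + B.rank := by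
  have h : LinearMap.range (A + B).mulVecLin ≤
      LinearMap.range A.mulVecLin ⊔ LinearMap.range B.mulVecLin := by
    rintro _ ⟨x, rfl⟩
    rw [Matrix.mulVecLin_add, LinearMap.add_apply]
    exact Submodule.add_mem_sup ⟨x, rfl⟩ ⟨x, rfl⟩
  exact (Submodule.finrank_mono h).trans (Submodule.finrank_add_le_finrank_add_finrank _ _)

lemma rank_intCast_zmod_le (p : ℕ) [Fact p.Prime] (A : Matrix m n ℤ) :
    (A.map (Int.cast : ℤ → ZMod p)).rank ≤ (A.map (Int.cast : ℤ → ℚ)).rank := by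
  obtain ⟨r, hr⟩ : ∃ r, (A.map (Int.cast : ℤ → ZMod p)).rank = r := ⟨_, rfl⟩
  obtain ⟨B, C, h⟩ := exists_mul_mul_eq_one _ hr
  rw [hr]
  obtain ⟨B', rfl⟩ : ∃ B' : Matrix (Fin r) m ℤ, B'.map (Int.cast : ℤ → ZMod p) = B := by
    choose f hf using ZMod.intCast_surjective (n := p)
    exact ⟨B.map f, by ext; simp [hf]⟩
  obtain ⟨C', rfl⟩ : ∃ C' : Matrix n (Fin r) ℤ, C'.map (Int.cast : ℤ → ZMod p) = C := by
    choose f hf using ZMod.intCast_surjective (n := p)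
    exact ⟨C.map f, by ext; simp [hf]⟩
  have hmap : ∀ (S : Type) [CommRing S], B'.map (Int.cast : ℤ → S) * A.map (Int.cast : ℤ → S) *
      C'.map (Int.cast : ℤ → S) = (B' * A * C').map (Int.castRingHom S) := by
    intro S _
    rw [Matrix.map_mul, Matrix.map_mul]
    rfl
  -- The lifted determinant is 1 modulo p, so it is nonzero over ℤ and the rational rank is at least
  -- r.
  have hdet : (B' * A * C').det ≠ 0 := by
    intro h0
    have := congrArg Matrix.det h
    rw [hmap, ← RingHom.mapMatrix_apply, ← RingHom.map_det, h0] at this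
    simp at this
  have hdet' : ((B' * A * C').map (Int.castRingHom ℚ)).det ≠ 0 := by
    rw [← RingHom.mapMatrix_apply, ← RingHom.map_det]
    simpa using hdet
  calc r = ((B' * A * C').map (Int.castRingHom ℚ)).rank := by
        rw [Matrix.rank_of_det_ne_zero hdet', Fintype.card_fin]
    _ ≤ _ := by
        rw [← hmap]
        exact (Matrix.rank_mul_le_left _ _).trans (Matrix.rank_mul_le_right _ _)

/-- If `M (D - M) = 0` with `D` diagonal and invertible modulo `p`, then `M` has the same rank
modulo `p` as over the rationals. -/
lemma rank_zmod_eq_rank_rat (p : ℕ) [Fact p.Prime] (M : Matrix n n ℤ) (D : n → ℤ)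
    (hM : M * (Matrix.diagonal D - M) = 0) (hp : ∀ i, (D i : ZMod p) ≠ 0) :
    (M.map (Int.cast : ℤ → ZMod p)).rank = (M.map (Int.cast : ℤ → ℚ)).rank := by
  set B := Matrix.diagonal D - M
  have h1 := rank_intCast_zmod_le p M
  have h2 := rank_intCast_zmod_le p B
  -- Over ℚ the ranks of M and B add up to at most n because MB = 0; modulo p they add up to at
  -- least n because M + B = D is invertible. As ranks cannot grow under reduction, all inequalities
  -- are equalities.
  have h3 : (M.map (Int.cast : ℤ → ℚ)).rank + (B.map (Int.cast : ℤ → ℚ)).rank ≤ Fintype.card n := by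
    apply Matrix.rank_add_rank_le_card_of_mul_eq_zero
    have := congrArg (fun X => X.map (Int.castRingHom ℚ)) hM
    simp only [Matrix.map_mul] at this
    simpa using this
  have h4 : Fintype.card n ≤
      (M.map (Int.cast : ℤ → ZMod p)).rank + (B.map (Int.cast : ℤ → ZMod p)).rank := by
    have : Matrix.diagonal (fun i => (D i : ZMod p)) =
        M.map (Int.cast : ℤ → ZMod p) + B.map (Int.cast : ℤ → ZMod p) := by
      ext i j
      simp only [B, Matrix.add_apply, Matrix.map_apply, Matrix.sub_apply, Matrix.diagonal_apply]
      split_ifs <;> simp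
    calc Fintype.card n = (Matrix.diagonal (fun i => (D i : ZMod p))).rank := by
          rw [Matrix.rank_of_det_ne_zero]
          rw [Matrix.det_diagonal]
          exact Finset.prod_ne_zero_iff.2 fun i _ => hp i
      _ ≤ _ := by rw [this]; exact rank_add_le _ _
  omega

end Rank

lemma finrank_map_eq_of_injOn {F V W : Type*} [Field F] [AddCommGroup V] [Module F V]
    [AddCommGroup W] [Module F W] (f : V →ₗ[F] W) (S : Submodule F V)
    (h : ∀ x ∈ S, f x = 0 → x = 0) : Module.finrank F (S.map f) = Module.finrank F S := by
  rw [← LinearMap.range_domRestrict]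
  apply LinearMap.finrank_range_of_inj
  rw [← LinearMap.ker_eq_bot, LinearMap.ker_eq_bot']
  exact fun x hx => Subtype.ext (h x.1 x.2 hx)

/-! ### Independence of d_k from the prime. -/

section Dimension

/-- The matrix of the Dynkin operator weighted by the letter `0`, on the words of length `k`. -/
def dynkinMatrix (k : ℕ) : Matrix (wordsOfLength k) (wordsOfLength k) ℤ :=
  fun w v => coeff v.1 (thetaWord (Pi.single 0 1 : Fin 2 → ℤ) w.1)

variable {R : Type*} [CommRing R]

lemma coeff_thetaWord_of_length_ne (δ : Fin 2 → R) : ∀ {w v : List (Fin 2)},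
    v.length ≠ w.length → coeff v (thetaWord δ w) = 0
  | [], v, _ => by simp [thetaWord]
  | [s], v, h => by
    have hs : FreeAlgebra.ι R s = monom R [s] := by simp
    rw [thetaWord, map_smul, hs, coeff_monom, if_neg, smul_zero]
    rintro rfl
    exact h rfl
  | s :: t :: w, v, h => by
    rw [thetaWord, LieRing.of_associative_ring_bracket, map_sub]
    have h1 : coeff v (FreeAlgebra.ι R s * thetaWord δ (t :: w)) = 0 := by
      cases v with
      | nil => exact coeff_nil_ι_mul _ _
      | cons x v =>
        rw [coeff_cons_ι_mul, coeff_thetaWord_of_length_ne δ (by simpa using h), ite_self]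
    have h2 : coeff v (thetaWord δ (t :: w) * FreeAlgebra.ι R s) = 0 := by
      cases v using List.reverseRecOn with
      | nil => exact coeff_nil_mul_ι _ _
      | append_singleton v x =>
        rw [coeff_concat_mul_ι, coeff_thetaWord_of_length_ne δ (by simpa using h), ite_self]
    rw [h1, h2, sub_zero]

lemma coeff_replicate_commutator (n : ℕ) (t s : Fin 2) (a : FreeAlgebra R (Fin 2)) :
    coeff (List.replicate (n + 1) t) ⁅FreeAlgebra.ι R s, a⁆ = 0 := by
  rw [LieRing.of_associative_ring_bracket, map_sub, List.replicate_succ, coeff_cons_ι_mul,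
    ← List.replicate_succ, List.replicate_succ', coeff_concat_mul_ι, sub_self]

lemma coeff_replicate_thetaWord (δ : Fin 2 → R) (w : List (Fin 2)) (n : ℕ) (t : Fin 2) :
    coeff (List.replicate (n + 2) t) (thetaWord δ w) = 0 := by
  match w with
  | [] => simp [thetaWord]
  | [s] => exact coeff_thetaWord_of_length_ne δ (by simp)
  | s :: t' :: w => exact coeff_replicate_commutator (n + 1) t s _

/-- The weight of a word with respect to the letter `0`, replaced by `1` for words in one letter. -/
def wordWeight (w : List (Fin 2)) : ℤ :=
  if w = List.replicate w.length 0 ∨ w = List.replicate w.length 1 then 1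
  else (w.map (Pi.single 0 1 : Fin 2 → ℤ)).sum

lemma sum_map_single_bounds (w : List (Fin 2)) :
    0 ≤ (w.map (Pi.single 0 1 : Fin 2 → ℤ)).sum ∧
      (w.map (Pi.single 0 1 : Fin 2 → ℤ)).sum ≤ w.length ∧
      ((w.map (Pi.single 0 1 : Fin 2 → ℤ)).sum = 0 → w = List.replicate w.length 1) ∧
      ((w.map (Pi.single 0 1 : Fin 2 → ℤ)).sum = w.length → w = List.replicate w.length 0) := by
  induction w with
  | nil => simp
  | cons s w ih =>
    obtain ⟨h1, h2, h3, h4⟩ := ih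
    fin_cases s
    · simp only [Fin.zero_eta, List.map_cons, Pi.single_eq_same, List.sum_cons, List.length_cons,
        Nat.cast_add, Nat.cast_one, List.replicate_succ, List.cons.injEq]
      refine ⟨by omega, by omega, fun h => by omega, fun h => ⟨trivial, h4 (by omega)⟩⟩
    · simp only [Fin.mk_one, List.map_cons, ne_eq, one_ne_zero, not_false_eq_true,
        Pi.single_eq_of_ne, List.sum_cons, List.length_cons, Nat.cast_add, Nat.cast_one,
        List.replicate_succ, List.cons.injEq, zero_add]
      refine ⟨by omega, by omega, fun h => ⟨trivial, h3 h⟩, fun h => by omega⟩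

/-- A word containing both letters has between 1 and length - 1 letters 0, so its weight is prime to
p even when the length equals p. Weighting by total length would fail in that case, which occurs for
d_{k+1} when k+1 = c = p. -/
lemma wordWeight_ne_zero {p : ℕ} [hp : Fact p.Prime] {w : List (Fin 2)} (hw : w.length ≤ p) :
    (wordWeight w : ZMod p) ≠ 0 := by
  rw [wordWeight]
  split_ifs with h
  · simp
  · obtain ⟨h1, h2, h3, h4⟩ := sum_map_single_bounds w
    push Not at h
    rw [Ne, ZMod.intCast_zmod_eq_zero_iff_dvd]
    intro hd
    have h5 : (w.map (Pi.single 0 1 : Fin 2 → ℤ)).sum ≠ 0 := fun h0 => h.2 (h3 h0)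
    have h6 : (w.map (Pi.single 0 1 : Fin 2 → ℤ)).sum ≠ w.length := fun h0 => h.1 (h4 h0)
    have := Int.le_of_dvd (by omega) hd
    omega

lemma eq_sum_monom {k : ℕ} {a : FreeAlgebra R (Fin 2)}
    (ha : ∀ w : List (Fin 2), w.length ≠ k → coeff w a = 0) :
    a = ∑ w : wordsOfLength k, coeff w.1 a • monom R w.1 := by
  refine ext_coeff fun v => ?_
  simp only [map_sum, map_smul, coeff_monom, smul_eq_mul]
  by_cases hv : v.length = k
  · rw [Finset.sum_eq_single_of_mem ⟨v, mem_wordsOfLength.2 hv⟩ (by simp)]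
    · simp
    · intro b _ hb
      rw [if_neg, mul_zero]
      exact fun h => hb (Subtype.ext h)
  · rw [ha v hv]
    symm
    refine Finset.sum_eq_zero fun w _ => ?_
    rw [if_neg, mul_zero]
    rintro rfl
    exact hv (mem_wordsOfLength.1 w.2)

/-- Rows of the matrix are coefficient vectors of Lie elements, on which θ acts as the Euler
derivation; hence M² is M with each column multiplied by the weight of its word. -/
lemma dynkinMatrix_mul (k : ℕ) : dynkinMatrix (k + 2) *
    (Matrix.diagonal (fun w => wordWeight w.1) - dynkinMatrix (k + 2)) = 0 := by
  rw [mul_sub, sub_eq_zero]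
  ext w u
  rw [Matrix.mul_diagonal]
  have hlen : w.1.length = k + 2 := mem_wordsOfLength.1 w.2
  have hulen : u.1.length = k + 2 := mem_wordsOfLength.1 u.2
  have h1 : (dynkinMatrix (k + 2) * dynkinMatrix (k + 2)) w u =
      coeff u.1 (theta (Pi.single 0 1 : Fin 2 → ℤ) (thetaWord (Pi.single 0 1) w.1)) := by
    rw [eq_sum_monom (k := k + 2) (a := thetaWord (Pi.single 0 1) w.1) fun v hv =>
      coeff_thetaWord_of_length_ne _ (by omega)]
    simp [Matrix.mul_apply, dynkinMatrix]
  rw [h1, theta_eq_euler _ (thetaWord_mem _ _), coeff_euler, dynkinMatrix, wordWeight, mul_comm]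
  -- For a power of a single letter the column is zero, so replacing its weight by 1 changes
  -- nothing.
  split_ifs with h
  · rw [hulen] at h
    rcases h with h | h <;> rw [h, coeff_replicate_thetaWord] <;> simp
  · rfl

/-- The coordinates of the homogeneous part of degree `k`. -/
def coeffs (R : Type*) [CommRing R] (k : ℕ) :
    FreeAlgebra R (Fin 2) →ₗ[R] (wordsOfLength k → R) :=
  LinearMap.pi fun w => coeff w.1

variable {p c : ℕ} [Fact p.Prime]

lemma coeff_replicate_of_mem {k : ℕ} {x : freeLie p} (hx : x ∈ freeLieComp p (k + 2)) (t : Fin 2) :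
    coeff (List.replicate (k + 2) t) (x : FreeAlgebra (ZMod p) (Fin 2)) = 0 := by
  suffices freeLieComp p (k + 2) ≤ LinearMap.ker
      (coeff (List.replicate (k + 2) t) ∘ₗ (freeLie p).toSubmodule.subtype) from this hx
  rw [freeLieComp_succ]
  refine iSup_le fun i => ?_
  rintro _ ⟨y, _, rfl⟩
  exact coeff_replicate_commutator (k + 1) t i _

/-- The row space consists of values of θ and lies in the component. Conversely θ maps the component
injectively into the row space: it multiplies coefficients by nonzero weights, except on powers of
one letter, where Lie elements of degree at least 2 have no coefficient. -/
lemma finrank_freeLieComp {k : ℕ} (hp : k + 2 ≤ p) :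
    Module.finrank (ZMod p) (freeLieComp p (k + 2)) =
      ((dynkinMatrix (k + 2)).map (Int.cast : ℤ → ZMod p)).rank := by
  set Φ : freeLie p →ₗ[ZMod p] (wordsOfLength (k + 2) → ZMod p) :=
    coeffs (ZMod p) (k + 2) ∘ₗ (freeLie p).toSubmodule.subtype
  have hinj : ∀ x ∈ freeLieComp p (k + 2), Φ x = 0 → x = 0 := by
    intro x hx h
    refine Subtype.ext (ext_coeff fun w => ?_)
    by_cases hw : w.length = k + 2
    · rw [ZeroMemClass.coe_zero, map_zero]
      exact congrFun h ⟨w, mem_wordsOfLength.2 hw⟩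
    · simpa using mem_freeLieComp.1 hx w hw
  set δ : Fin 2 → ZMod p := fun s => ((Pi.single 0 1 : Fin 2 → ℤ) s : ZMod p)
  set T := Submodule.span (ZMod p)
    (Set.range ((dynkinMatrix (k + 2)).map (Int.cast : ℤ → ZMod p)).row)
  have hrow : ∀ w : wordsOfLength (k + 2),
      ((dynkinMatrix (k + 2)).map (Int.cast : ℤ → ZMod p)).row w =
        coeffs (ZMod p) (k + 2) (thetaWord δ w.1) := by
    intro w
    funext v
    exact (coeff_thetaWord_intCast _ w.1 v.1).symm
  have hT : T ≤ (freeLieComp p (k + 2)).map Φ := by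
    rw [Submodule.span_le]
    rintro _ ⟨w, rfl⟩
    rw [hrow]
    refine ⟨⟨thetaWord δ w.1, thetaWord_mem δ w.1⟩, mem_freeLieComp.2 fun v hv => ?_, rfl⟩
    have := mem_wordsOfLength.1 w.2
    exact coeff_thetaWord_of_length_ne δ (by omega)
  rw [Matrix.rank_eq_finrank_span_row, ← finrank_map_eq_of_injOn Φ _ hinj]
  refine le_antisymm ?_ (Submodule.finrank_mono hT)
  rw [finrank_map_eq_of_injOn Φ _ hinj]
  have hθ : ∀ x ∈ freeLieComp p (k + 2), coeffs (ZMod p) (k + 2) (theta δ x.1) ∈ T := by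
    intro x hx
    rw [eq_sum_monom (mem_freeLieComp.1 hx)]
    simp only [map_sum, map_smul, theta_monom, ← hrow]
    exact sum_mem fun w _ => T.smul_mem _ (Submodule.subset_span ⟨w, rfl⟩)
  set Ψ : freeLie p →ₗ[ZMod p] (wordsOfLength (k + 2) → ZMod p) :=
    coeffs (ZMod p) (k + 2) ∘ₗ theta δ ∘ₗ (freeLie p).toSubmodule.subtype
  have hΨ : ∀ x ∈ freeLieComp p (k + 2), Ψ x = 0 → x = 0 := by
    intro x hx h
    refine Subtype.ext (ext_coeff fun w => ?_)
    by_cases hw : w.length = k + 2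
    · have h1 : coeff w (theta δ (x : FreeAlgebra (ZMod p) (Fin 2))) = 0 :=
        congrFun h ⟨w, mem_wordsOfLength.2 hw⟩
      rw [theta_eq_euler δ x.2, coeff_euler] at h1
      rw [ZeroMemClass.coe_zero, map_zero]
      by_cases hc : w = List.replicate w.length 0 ∨ w = List.replicate w.length 1
      · rw [hw] at hc
        rcases hc with hc | hc <;> rw [hc, coeff_replicate_of_mem hx]
      · have h2 := wordWeight_ne_zero (p := p) (w := w) (by omega)
        rw [wordWeight, if_neg hc] at h2
        refine (mul_eq_zero.1 h1).resolve_left fun h3 => h2 ?_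
        rw [← h3, Int.cast_list_sum, List.map_map]
        rfl
    · simpa using mem_freeLieComp.1 hx w hw
  rw [← finrank_map_eq_of_injOn Ψ _ hΨ]
  refine Submodule.finrank_mono ?_
  rintro _ ⟨x, hx, rfl⟩
  exact hθ x hx

lemma d_eq_finrank {k : ℕ} (hk : k ≤ c) :
    d p c k = Module.finrank (ZMod p) (freeLieComp p k) :=
  finrank_map_eq_of_injOn _ _ fun _ hx h =>
    eq_of_proj_eq hk hx (zero_mem _) (h.trans (map_zero _).symm)

lemma d_one (hc : 1 ≤ c) : d p c 1 = 2 := by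
  rw [d_eq_finrank hc, ← rightNormed_eq, rightNormed, finrank_span_eq_card]
  · simp
  · have h : LinearIndependent (ZMod p) (fun i : Fin 2 => FreeAlgebra.ι (ZMod p) i) := by
      have := (wordBasis (ZMod p)).linearIndependent.comp (fun i : Fin 2 => [i])
        (fun i j h => by simpa using h)
      simpa [Function.comp_def] using this
    exact LinearIndependent.of_comp (freeLie p).toSubmodule.subtype h

/-- The dimensions of the homogeneous components do not depend on the prime. -/
lemma exists_d_eq {k : ℕ} (hk : 1 ≤ k) :
    ∃ D : ℕ, ∀ (p c : ℕ) [Fact p.Prime], k ≤ c → c ≤ p → d p c k = D := by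
  obtain rfl | ⟨j, rfl⟩ : k = 1 ∨ ∃ j, k = j + 2 := by
    rcases k with _ | _ | j
    · omega
    · exact Or.inl rfl
    · exact Or.inr ⟨j, rfl⟩
  -- Degree 1 is separate because the letters themselves are Lie elements supported on one-letter
  -- words.
  · exact ⟨2, fun p c _ hc _ => d_one hc⟩
  · refine ⟨((dynkinMatrix (j + 2)).map (Int.cast : ℤ → ℚ)).rank, fun p c _ hkc hcp => ?_⟩
    rw [d_eq_finrank hkc, finrank_freeLieComp (hkc.trans hcp)]
    refine rank_zmod_eq_rank_rat p _ _ (dynkinMatrix_mul j) fun w => ?_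
    have := mem_wordsOfLength.1 w.2
    exact wordWeight_ne_zero (by omega)

end Dimension

/-! ### Gaussian binomials as polynomials. -/

section GaussPoly

/-- The Gaussian binomial coefficients as polynomials. -/
def gaussPoly : ℕ → ℕ → ℚ[X]
  | _, 0 => 1
  | 0, _ + 1 => 0
  | n + 1, i + 1 => gaussPoly n i + X ^ (i + 1) * gaussPoly n (i + 1)

lemma gaussPoly_zero_right (n : ℕ) : gaussPoly n 0 = 1 := by cases n <;> rfl

lemma gaussPoly_of_lt : ∀ {n i : ℕ}, n < i → gaussPoly n i = 0
  | 0, i + 1, _ => rfl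
  | n + 1, i + 1, h => by
    rw [gaussPoly, gaussPoly_of_lt (by omega), gaussPoly_of_lt (by omega), mul_zero, add_zero]

lemma gaussPoly_self : ∀ n : ℕ, gaussPoly n n = 1
  | 0 => rfl
  | n + 1 => by
    rw [gaussPoly, gaussPoly_self n, gaussPoly_of_lt (by omega), mul_zero, add_zero]

/-- The quotient formula follows from the q-Pascal recursion in this division-free form. It also
covers n < i, where truncated subtraction gives the right side a factor 1 - q⁰ = 0. -/
lemma gaussPoly_eval_mul (q : ℚ) : ∀ n i : ℕ,
    (gaussPoly n i).eval q * ∏ j ∈ Finset.range i, (1 - q ^ (j + 1)) =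
      ∏ j ∈ Finset.range i, (1 - q ^ (n - j))
  | n, 0 => by simp [gaussPoly_zero_right]
  | 0, i + 1 => by
    rw [Finset.prod_range_succ']
    simp [gaussPoly]
  | n + 1, i + 1 => by
    have h1 := gaussPoly_eval_mul q n i
    have h2 := gaussPoly_eval_mul q n (i + 1)
    rw [Finset.prod_range_succ (fun j => 1 - q ^ (n - j))] at h2
    rw [Finset.prod_range_succ' (fun j => 1 - q ^ (n + 1 - j))]
    simp only [Nat.add_sub_add_right, Nat.sub_zero]
    rw [← h1] at h2 ⊢
    rw [gaussPoly]
    simp only [eval_add, eval_mul, eval_pow, eval_X]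
    rw [add_mul, mul_assoc, h2, Finset.prod_range_succ]
    rcases le_or_gt i n with hin | hin
    · have : q ^ (n + 1) = q ^ (i + 1) * q ^ (n - i) := by rw [← pow_add]; congr 1; omega
      rw [this]; ring
    · rw [gaussPoly_of_lt hin]; simp

lemma prod_one_sub_pow_ne_zero {q : ℚ} (hq : 1 < q) (i : ℕ) :
    ∏ j ∈ Finset.range i, (1 - q ^ (j + 1)) ≠ 0 := by
  refine Finset.prod_ne_zero_iff.2 fun j _ => ?_
  have : 1 < q ^ (j + 1) := one_lt_pow₀ hq (by omega)
  exact (sub_neg.2 this).ne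

lemma gaussBinom_eq_eval {q : ℚ} (hq : 1 < q) (n i : ℤ) : gaussBinom n i q =
    (if 0 ≤ i then gaussPoly n.toNat i.toNat else 0).eval q := by
  rw [gaussBinom]
  split_ifs with h1 h2 h3 h4 h4
  · subst h1; simp [gaussPoly_zero_right]
  · omega
  · rw [div_eq_iff (prod_one_sub_pow_ne_zero hq _), gaussPoly_eval_mul]
  · omega
  · rw [gaussPoly_of_lt (by omega), eval_zero]
  · simp

lemma gaussBinom_natCast {q : ℚ} (hq : 1 < q) (n i : ℕ) :
    gaussBinom n i q = (gaussPoly n i).eval q := by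
  rw [gaussBinom_eq_eval hq, if_pos (by omega)]; simp

end GaussPoly

/-! ### Counting subspaces over the prime field. -/

section Counting

variable {p : ℕ} [hp : Fact p.Prime]

lemma one_lt_cast_prime : (1 : ℚ) < p := by exact_mod_cast hp.out.one_lt

section Subspaces

variable {V : Type*} [AddCommGroup V] [Module (ZMod p) V] [Finite V]

/-- A linearly independent tuple is a basis of its span. -/
def linearIndependentEquiv (p : ℕ) [Fact p.Prime] (V : Type*) [AddCommGroup V] [Module (ZMod p) V]
    [Finite V] (r : ℕ) :
    (Σ U : {U : Submodule (ZMod p) V // Module.finrank (ZMod p) U = r},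
        {t : Fin r → U.1 // LinearIndependent (ZMod p) t}) ≃
      {s : Fin r → V // LinearIndependent (ZMod p) s} :=
  Equiv.ofBijective
    (fun x => ⟨fun i => (x.2.1 i : V), x.2.2.map' (Submodule.subtype _) (Submodule.ker_subtype _)⟩)
    (by
      have hspan : ∀ (U : Submodule (ZMod p) V) (t : Fin r → U), Module.finrank (ZMod p) U = r →
          LinearIndependent (ZMod p) t →
            Submodule.span (ZMod p) (Set.range fun i => (t i : V)) = U := by
        intro U t hU ht
        have ht' : LinearIndependent (ZMod p) fun i => (t i : V) :=
          ht.map' (Submodule.subtype _) (Submodule.ker_subtype _)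
        refine Submodule.eq_of_le_of_finrank_eq ?_ ?_
        · rw [Submodule.span_le]
          rintro _ ⟨i, rfl⟩
          exact (t i).2
        · rw [finrank_span_eq_card ht', Fintype.card_fin, hU]
      constructor
      · rintro ⟨⟨U, hU⟩, ⟨t, ht⟩⟩ ⟨⟨U', hU'⟩, ⟨t', ht'⟩⟩ h
        have h' : (fun i => (t i : V)) = fun i => (t' i : V) := congrArg Subtype.val h
        have hUU : U = U' := by rw [← hspan U t hU ht, ← hspan U' t' hU' ht', h']
        subst hUU
        have : t = t' := funext fun i => Subtype.ext (congrFun h' i)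
        subst this
        rfl
      · rintro ⟨s, hs⟩
        exact ⟨⟨⟨Submodule.span (ZMod p) (Set.range s), by
            rw [finrank_span_eq_card hs, Fintype.card_fin]⟩,
          ⟨fun i => ⟨s i, Submodule.subset_span ⟨i, rfl⟩⟩,
            LinearIndependent.of_comp (Submodule.subtype _) hs⟩⟩, rfl⟩)

lemma prod_pow_sub_pow {q n r : ℕ} (hq : 0 < q) (hr : r ≤ n) :
    ((∏ i : Fin r, (q ^ n - q ^ i.val) : ℕ) : ℚ) =
      (∏ i ∈ Finset.range r, (-(q : ℚ) ^ i)) * ∏ i ∈ Finset.range r, (1 - (q : ℚ) ^ (n - i)) := by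
  rw [Fin.prod_univ_eq_prod_range (fun i => q ^ n - q ^ i) r, ← Finset.prod_mul_distrib,
    Nat.cast_prod]
  refine Finset.prod_congr rfl fun i hi => ?_
  have hi' : i < r := Finset.mem_range.1 hi
  have : (q : ℚ) ^ n = (q : ℚ) ^ i * (q : ℚ) ^ (n - i) := by rw [← pow_add]; congr 1; omega
  rw [Nat.cast_sub (Nat.pow_le_pow_right hq (by omega)), Nat.cast_pow, Nat.cast_pow, this]
  ring

/-- Linearly independent r-tuples are counted directly and by their spans; the factors -pⁱ common to
both products cancel. -/
lemma card_submodule_finrank_eq (r : ℕ) :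
    (Nat.card {U : Submodule (ZMod p) V // Module.finrank (ZMod p) U = r} : ℚ) =
      (gaussPoly (Module.finrank (ZMod p) V) r).eval (p : ℚ) := by
  have : Fintype V := Fintype.ofFinite V
  set n := Module.finrank (ZMod p) V with hn
  rcases lt_or_ge n r with h | h
  · rw [gaussPoly_of_lt h, eval_zero]
    have : IsEmpty {U : Submodule (ZMod p) V // Module.finrank (ZMod p) U = r} :=
      ⟨fun U => by have := Submodule.finrank_le U.1; omega⟩
    simp
  · have hcard := (Nat.card_congr (linearIndependentEquiv p V r)).symm
    have : Fintype {U : Submodule (ZMod p) V // Module.finrank (ZMod p) U = r} := Fintype.ofFinite _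
    rw [Nat.card_sigma, card_linearIndependent (by omega)] at hcard
    have h2 : ∀ U : {U : Submodule (ZMod p) V // Module.finrank (ZMod p) U = r},
        Nat.card {t : Fin r → U.1 // LinearIndependent (ZMod p) t} =
          ∏ i : Fin r, (p ^ r - p ^ i.val) := by
      intro U
      rw [card_linearIndependent U.2.ge, U.2, ZMod.card]
    simp only [h2, ZMod.card, Finset.sum_const, Finset.card_univ, smul_eq_mul] at hcard
    have hc := congrArg (Nat.cast : ℕ → ℚ) hcard
    rw [Nat.cast_mul, prod_pow_sub_pow hp.out.pos h, prod_pow_sub_pow hp.out.pos le_rfl,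
      ← gaussPoly_eval_mul, ← Finset.prod_range_reflect (fun i => 1 - (p : ℚ) ^ (r - i))] at hc
    have h3 : ∏ j ∈ Finset.range r, (1 - (p : ℚ) ^ (r - (r - 1 - j))) =
        ∏ j ∈ Finset.range r, (1 - (p : ℚ) ^ (j + 1)) := by
      refine Finset.prod_congr rfl fun j hj => ?_
      have := Finset.mem_range.1 hj
      congr 2; omega
    rw [h3] at hc
    have h4 := prod_one_sub_pow_ne_zero (one_lt_cast_prime (p := p)) r
    have h5 : ∏ i ∈ Finset.range r, (-(p : ℚ) ^ i) ≠ 0 :=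
      Finset.prod_ne_zero_iff.2 fun i _ => neg_ne_zero.2
        (pow_ne_zero _ (by exact_mod_cast hp.out.ne_zero))
    rw [Nat.card_eq_fintype_card]
    apply mul_right_cancel₀ (mul_ne_zero h5 h4)
    rw [← hc]
    ring

omit [Finite V] in
lemma finrank_map_mkQ [FiniteDimensional (ZMod p) V] {A S : Submodule (ZMod p) V} (h : A ≤ S) :
    Module.finrank (ZMod p) (S.map A.mkQ) + Module.finrank (ZMod p) A =
      Module.finrank (ZMod p) S := by
  have hker : LinearMap.ker (A.mkQ.domRestrict S) = A.submoduleOf S := by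
    ext x
    simp [Submodule.submoduleOf]
  rw [← LinearMap.finrank_range_add_finrank_ker (A.mkQ.domRestrict S), LinearMap.range_domRestrict,
    hker, (Submodule.submoduleOfEquivOfLe h).finrank_eq]

/-- The number of subspaces of a given dimension between two subspaces. -/
lemma ncard_interval {A E : Submodule (ZMod p) V} (hAE : A ≤ E) (s : ℤ) :
    ({J : Submodule (ZMod p) V | A ≤ J ∧ J ≤ E ∧ (Module.finrank (ZMod p) J : ℤ) = s}.ncard : ℚ) =
      gaussBinom ((Module.finrank (ZMod p) E : ℤ) - Module.finrank (ZMod p) A)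
        (s - Module.finrank (ZMod p) A) (p : ℚ) := by
  have hle := Submodule.finrank_mono hAE
  -- Since s is an arbitrary integer it may lie below dim A; then there is no such subspace, and the
  -- Gaussian binomial with negative lower index is 0.
  rcases lt_or_ge s (Module.finrank (ZMod p) A) with h | h
  · have : {J : Submodule (ZMod p) V |
        A ≤ J ∧ J ≤ E ∧ (Module.finrank (ZMod p) J : ℤ) = s} = ∅ := by
      refine Set.eq_empty_of_forall_notMem ?_
      rintro J ⟨h1, _, h3⟩
      have := Submodule.finrank_mono h1
      omega
    rw [this, gaussBinom_eq_eval one_lt_cast_prime, if_neg (by omega)]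
    simp
  · obtain ⟨r, rfl⟩ : ∃ r : ℕ, s = Module.finrank (ZMod p) A + r :=
      ⟨(s - Module.finrank (ZMod p) A).toNat, by omega⟩
    set A' := A.submoduleOf E
    have hA' : Module.finrank (ZMod p) A' = Module.finrank (ZMod p) A :=
      (Submodule.submoduleOfEquivOfLe hAE).finrank_eq
    have : Finite (E ⧸ A') := Finite.of_surjective _ (Submodule.mkQ_surjective A')
    have hq : Module.finrank (ZMod p) (E ⧸ A') =
        Module.finrank (ZMod p) E - Module.finrank (ZMod p) A := by
      have := Submodule.finrank_quotient_add_finrank A'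
      omega
    rw [add_sub_cancel_left, ← Nat.cast_sub hle, gaussBinom_natCast one_lt_cast_prime, ← hq,
      ← card_submodule_finrank_eq, ← Nat.card_coe_set_eq]
    congr 1
    refine Nat.card_congr (Equiv.symm (Equiv.ofBijective
      (fun U => ⟨(U.1.comap A'.mkQ).map E.subtype, ?_, ?_, ?_⟩) ⟨?_, ?_⟩))
    · intro x hx
      refine ⟨⟨x, hAE hx⟩, ?_, rfl⟩
      have : A'.mkQ ⟨x, hAE hx⟩ = 0 := by
        rw [Submodule.mkQ_apply, Submodule.Quotient.mk_eq_zero]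
        exact hx
      simp only [SetLike.mem_coe, Submodule.mem_comap, this, zero_mem]
    · exact Submodule.map_subtype_le _ _
    · rw [finrank_map_eq_of_injOn _ _ fun x _ hx => by simpa using hx]
      have h1 : (U.1.comap A'.mkQ).map A'.mkQ = U.1 :=
        Submodule.map_comap_eq_of_surjective (Submodule.mkQ_surjective _) _
      have h2 := finrank_map_mkQ (A'.le_comap_mkQ U.1)
      rw [h1, U.2, hA'] at h2
      omega
    · rintro ⟨U, _⟩ ⟨U', _⟩ h
      have h' := congrArg Subtype.val h
      simp only at h'
      have h1 := Submodule.map_injective_of_injective E.injective_subtype h'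
      exact Subtype.ext (Submodule.comap_injective_of_surjective (Submodule.mkQ_surjective _) h1)
    · rintro ⟨J, h1, h2, h3⟩
      have hle : A' ≤ J.submoduleOf E := Submodule.comap_mono h1
      have h4 := finrank_map_mkQ hle
      rw [hA', (Submodule.submoduleOfEquivOfLe h2).finrank_eq] at h4
      refine ⟨⟨(J.submoduleOf E).map A'.mkQ, by omega⟩, Subtype.ext ?_⟩
      simp only [Submodule.comap_map_mkQ, sup_eq_right.2 hle]
      rw [Submodule.submoduleOf, Submodule.map_comap_subtype, inf_eq_right.2 h2]

end Subspaces

/-! ### Double counting and regrouping of finite sums. -/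

section Sums

open scoped Classical in
lemma ncard_eq_sum_ncard {α β : Type*} [Fintype α] [Finite β] (S : Set (α × β)) :
    S.ncard = ∑ a : α, {b | (a, b) ∈ S}.ncard := by
  have e : S ≃ Σ a : α, {b | (a, b) ∈ S} :=
    { toFun := fun x => ⟨x.1.1, x.1.2, x.2⟩
      invFun := fun x => ⟨(x.1, x.2.1), x.2.2⟩
      left_inv := fun _ => rfl
      right_inv := fun _ => rfl }
  rw [← Nat.card_coe_set_eq, Nat.card_congr e, Nat.card_sigma]
  rfl

open scoped Classical in
lemma ncard_eq_sum_ncard' {α β : Type*} [Finite α] [Fintype β] (S : Set (α × β)) :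
    S.ncard = ∑ b : β, {a | (a, b) ∈ S}.ncard := by
  have : Fintype α := Fintype.ofFinite α
  rw [← Set.ncard_image_of_injective S Prod.swap_injective, ncard_eq_sum_ncard]
  simp

lemma sum_ite_const {α : Type*} [Fintype α] (P : α → Prop) [DecidablePred P] (b : ℚ) :
    ∑ x, (if P x then b else 0) = ({x | P x}.ncard : ℚ) * b := by
  classical
  rw [← Finset.sum_filter, Finset.sum_const, nsmul_eq_mul, Set.ncard_eq_toFinset_card']
  congr 3
  ext x; simp

open scoped Classical in
/-- Regrouping a sum according to the values of two statistics. -/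
lemma sum_regroup {α : Type*} [Fintype α] (P : α → Prop) (u v : α → ℕ) (g : ℕ → ℕ → ℚ)
    (M : ℕ) (B : ℕ → ℕ) (hu : ∀ x, P x → u x < M) (hv : ∀ x, P x → v x < B (u x)) :
    ∑ x, (if P x then g (u x) (v x) else 0) =
      ∑ m ∈ Finset.range M, ∑ i ∈ Finset.range (B m),
        ({x | P x ∧ u x = m ∧ v x = i}.ncard : ℚ) * g m i := by
  have h : ∀ m i, ({x | P x ∧ u x = m ∧ v x = i}.ncard : ℚ) * g m i =
      ∑ x, if P x ∧ u x = m ∧ v x = i then g m i else 0 := by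
    intro m i
    rw [sum_ite_const]
  simp only [h]
  have h2 : ∀ m, ∑ i ∈ Finset.range (B m), ∑ x, (if P x ∧ u x = m ∧ v x = i then g m i else 0) =
      ∑ x, if P x ∧ u x = m then g (u x) (v x) else 0 := by
    intro m
    rw [Finset.sum_comm]
    refine Finset.sum_congr rfl fun x _ => ?_
    split_ifs with hx
    · obtain ⟨hx1, rfl⟩ := hx
      rw [Finset.sum_eq_single_of_mem (v x) (Finset.mem_range.2 (hv x hx1))]
      · simp [hx1]
      · intro b _ hb
        rw [if_neg]
        exact fun h => hb h.2.2.symm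
    · refine Finset.sum_eq_zero fun i _ => if_neg ?_
      exact fun h => hx ⟨h.1, h.2.1⟩
  simp only [h2]
  rw [Finset.sum_comm]
  refine Finset.sum_congr rfl fun x _ => ?_
  split_ifs with hx
  · rw [Finset.sum_eq_single_of_mem (u x) (Finset.mem_range.2 (hu x hx))]
    · simp [hx]
    · intro b _ hb
      rw [if_neg]
      exact fun h => hb h.2.symm
  · exact (Finset.sum_eq_zero fun m _ => if_neg fun h => hx h.1).symm

end Sums

end Counting

/-! ### One-step graded ideals as pairs of subspaces. -/

section Alpha

variable {p c : ℕ} [Fact p.Prime]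

/-- The ideal with components `J` and `J'` in weights `k` and `k + 1`. -/
def idealOfPair (p c k : ℕ) (J J' : Submodule (ZMod p) (FreeNilp p c))
    (hJ' : J' ≤ lieComp p c (k + 1)) (h : ∀ i, J.map (phi p c i) ≤ J') :
    LieIdeal (ZMod p) (FreeNilp p c) where
  __ := J ⊔ J' ⊔ upper p c (k + 2)
  lie_mem {x m} hm := by
    refine lie_mem_of_phi_mem (S := J ⊔ J' ⊔ upper p c (k + 2)) (fun i y hy => ?_) x hm
    suffices J ⊔ J' ⊔ upper p c (k + 2) ≤
      (J ⊔ J' ⊔ upper p c (k + 2)).comap (phi p c i) from this hy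
    refine sup_le (sup_le ?_ ?_) fun z hz => ?_
    · rw [← Submodule.map_le_iff_le_comap]
      exact (h i).trans (le_sup_right.trans le_sup_left)
    · intro z hz
      refine Submodule.mem_sup_right (?_ : phi p c i z ∈ upper p c (k + 2))
      have hz' := phi_mem i (hJ' hz)
      by_cases hkc : k + 2 ≤ c
      · exact (le_biSup (lieComp p c) (⟨le_rfl, hkc⟩ : k + 2 ∈ Set.Icc (k + 2) c)) hz'
      · rw [lieComp_eq_bot (by omega), Submodule.mem_bot] at hz'
        rw [hz']
        exact zero_mem _
    · exact Submodule.mem_sup_right (phi_upper_mem i hz)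

lemma inf_lieComp_of_eq {k : ℕ} (hkc : k + 1 ≤ c) {S J J' : Submodule (ZMod p) (FreeNilp p c)}
    (hJ : J ≤ lieComp p c k) (hJ' : J' ≤ lieComp p c (k + 1))
    (hS : S = J ⊔ J' ⊔ upper p c (k + 2)) :
    S ⊓ lieComp p c k = J ∧ S ⊓ lieComp p c (k + 1) = J' := by
  subst hS
  constructor
  · refine le_antisymm ?_ (le_inf (le_sup_left.trans le_sup_left) hJ)
    rintro x ⟨hx, hxk⟩
    obtain ⟨y, hy, r, hr, rfl⟩ := Submodule.mem_sup.1 hx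
    obtain ⟨a, ha, b, hb, rfl⟩ := Submodule.mem_sup.1 hy
    have := (eq_of_add_upper hkc hxk (zero_mem _) (hJ ha) (hJ' hb) hr (add_zero _)).1
    rwa [this]
  · refine le_antisymm ?_ (le_inf (le_sup_right.trans le_sup_left) hJ')
    rintro x ⟨hx, hxk⟩
    obtain ⟨y, hy, r, hr, rfl⟩ := Submodule.mem_sup.1 hx
    obtain ⟨a, ha, b, hb, rfl⟩ := Submodule.mem_sup.1 hy
    have := (eq_of_add_upper hkc (zero_mem _) hxk (hJ ha) (hJ' hb) hr (zero_add _)).2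
    rwa [this]

/-- The ideal condition only has to be tested on the two generators, and on the components of weight
at least k+1 it is automatic. -/
lemma alphaOne_eq_ncard_pairs {k : ℕ} (hkc : k + 1 ≤ c) (a : ℕ) : alphaOne p c k a =
    {x : Submodule (ZMod p) (FreeNilp p c) × Submodule (ZMod p) (FreeNilp p c) |
      (x.1 ≤ lieComp p c k ∧ x.2 ≤ lieComp p c (k + 1) ∧
        x.1.map (phi p c 0) ⊔ x.1.map (phi p c 1) ≤ x.2) ∧
      Module.finrank (ZMod p) x.1 + Module.finrank (ZMod p) x.2 = a}.ncard := by
  rw [alphaOne]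
  refine Set.ncard_congr
    (fun I _ => (I.toSubmodule ⊓ lieComp p c k, I.toSubmodule ⊓ lieComp p c (k + 1))) ?_ ?_ ?_
  · rintro I ⟨_, hdim⟩
    refine ⟨⟨inf_le_right, inf_le_right, ?_⟩, hdim⟩
    have h : ∀ i, (I.toSubmodule ⊓ lieComp p c k).map (phi p c i) ≤
        I.toSubmodule ⊓ lieComp p c (k + 1) := by
      rintro i _ ⟨x, ⟨hx, hxk⟩, rfl⟩
      exact ⟨I.lie_mem (x := proj p c (freeGen p i)) hx, phi_mem i hxk⟩
    exact sup_le (h 0) (h 1)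
  · rintro I I' ⟨⟨J, J', hJ, hJ', hI⟩, _⟩ ⟨⟨K, K', hK, hK', hI'⟩, _⟩ h
    obtain ⟨h1, h2⟩ := Prod.mk.inj h
    obtain ⟨e1, e2⟩ := inf_lieComp_of_eq hkc hJ hJ' hI
    obtain ⟨e3, e4⟩ := inf_lieComp_of_eq hkc hK hK' hI'
    rw [← LieSubmodule.toSubmodule_inj, hI, hI', ← e1, ← e2, ← e3, ← e4, h1, h2]
  · rintro ⟨J, J'⟩ ⟨⟨hJ, hJ', hle⟩, hdim⟩
    simp only at hJ hJ' hle hdim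
    have h : ∀ i, J.map (phi p c i) ≤ J' := by
      intro i
      fin_cases i
      · exact le_sup_left.trans hle
      · exact le_sup_right.trans hle
    have hS : (idealOfPair p c k J J' hJ' h).toSubmodule = J ⊔ J' ⊔ upper p c (k + 2) := rfl
    obtain ⟨e1, e2⟩ := inf_lieComp_of_eq hkc hJ hJ' hS
    refine ⟨idealOfPair p c k J J' hJ' h, ⟨⟨J, J', hJ, hJ', hS⟩, ?_⟩, ?_⟩
    · rw [e1, e2]; exact hdim
    · rw [e1, e2]

instance : Finite (Submodule (ZMod p) (FreeNilp p c)) :=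
  Finite.of_injective _ SetLike.coe_injective

instance : Fintype (Submodule (ZMod p) (FreeNilp p c)) := Fintype.ofFinite _

open scoped Classical in
/-- The number of one-step graded ideals as a sum over their components of weight `k`. -/
lemma alphaOne_eq_sum {k : ℕ} (hkc : k + 1 ≤ c) (a : ℕ) : (alphaOne p c k a : ℚ) =
    ∑ J : Submodule (ZMod p) (FreeNilp p c), if J ≤ lieComp p c k then
      gaussBinom ((d p c (k + 1) : ℤ) -
          Module.finrank (ZMod p) (J.map (phi p c 0) ⊔ J.map (phi p c 1) : Submodule _ _))
        ((a : ℤ) - Module.finrank (ZMod p) J -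
          Module.finrank (ZMod p) (J.map (phi p c 0) ⊔ J.map (phi p c 1) : Submodule _ _)) (p : ℚ)
      else 0 := by
  rw [alphaOne_eq_ncard_pairs hkc, ncard_eq_sum_ncard, Nat.cast_sum]
  refine Finset.sum_congr rfl fun J _ => ?_
  split_ifs with hJ
  · have hle : J.map (phi p c 0) ⊔ J.map (phi p c 1) ≤ lieComp p c (k + 1) := by
      refine sup_le ?_ ?_ <;> rintro _ ⟨x, hx, rfl⟩ <;> exact phi_mem _ (hJ hx)
    rw [d, ← ncard_interval hle]
    congr 2
    ext J'
    simp only [Set.mem_ofPred_eq, hJ, true_and]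
    constructor
    · rintro ⟨⟨h1, h2⟩, h3⟩
      exact ⟨h2, h1, by omega⟩
    · rintro ⟨h1, h2, h3⟩
      exact ⟨⟨h2, h1⟩, by omega⟩
  · rw [Nat.cast_eq_zero, Set.ncard_eq_zero]
    refine Set.eq_empty_of_forall_notMem fun J' h => hJ h.1.1

end Alpha

/-! ### Weight k ≥ 2: the formula for α₁ and the double count for f. -/

section HighWeight

variable {p c k : ℕ} [Fact p.Prime]

/-- These are the chains (u, 0, 0) and (0, 0, u) in the chain condition. -/
lemma phi_injOn (hp : c ≤ p) (hk : 2 ≤ k) (hkc : k + 1 ≤ c) (i : Fin 2) {u : FreeNilp p c}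
    (hu : u ∈ lieComp p c k) (h : phi p c i u = 0) : u = 0 := by
  fin_cases i
  · exact (phi_chain hp hk hkc hu (zero_mem _) (zero_mem _) (by simpa using h) (by simp)).1
  · exact (phi_chain hp hk hkc (zero_mem _) (zero_mem _) hu (by simp) (by simpa using h.symm)).2

variable {V : Submodule (ZMod p) (FreeNilp p c)}

lemma finrank_map_phi (hp : c ≤ p) (hk : 2 ≤ k) (hkc : k + 1 ≤ c) (hV : V ≤ lieComp p c k)
    (i : Fin 2) :
    Module.finrank (ZMod p) (V.map (phi p c i)) = Module.finrank (ZMod p) V :=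
  finrank_map_eq_of_injOn _ _ fun _ hx h => phi_injOn hp hk hkc i (hV hx) h

lemma finrank_sup_add_dimCol (hp : c ≤ p) (hk : 2 ≤ k) (hkc : k + 1 ≤ c)
    (hV : V ≤ lieComp p c k) :
    Module.finrank (ZMod p) (V.map (phi p c 0) ⊔ V.map (phi p c 1) : Submodule _ _) +
      dimCol p c V = 2 * Module.finrank (ZMod p) V := by
  rw [dimCol, Submodule.finrank_sup_add_finrank_inf_eq, finrank_map_phi hp hk hkc hV,
    finrank_map_phi hp hk hkc hV, two_mul]

/-- Since L_{k+1} = φ₁(L_k) + φ₂(L_k), this is the dimension formula for the full component; it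
transfers independence of p from the d's to l_{k+1}. -/
lemma ell_add_d (hp : c ≤ p) (hk : 2 ≤ k) (hkc : k + 1 ≤ c) :
    d p c (k + 1) + ell p c k = 2 * d p c k := by
  rw [d, lieComp_succ (by omega)]
  exact finrank_sup_add_dimCol hp hk hkc le_rfl

lemma dimCol_le_finrank (hp : c ≤ p) (hk : 2 ≤ k) (hkc : k + 1 ≤ c) (hV : V ≤ lieComp p c k) :
    dimCol p c V ≤ Module.finrank (ZMod p) V := by
  rw [← finrank_map_phi hp hk hkc hV 0]
  exact Submodule.finrank_mono inf_le_left

lemma dimCol_le_ell (hV : V ≤ lieComp p c k) : dimCol p c V ≤ ell p c k :=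
  Submodule.finrank_mono (inf_le_inf (Submodule.map_mono hV) (Submodule.map_mono hV))

theorem alphaOne_formula (hp : c ≤ p) (hk : 2 ≤ k) (hkc : k + 1 ≤ c) (a : ℕ) :
    (alphaOne p c k a : ℚ) =
      ∑ m ∈ Finset.range (d p c k + 1), ∑ i ∈ Finset.range (min m (ell p c k) + 1),
        (f p c k m i : ℚ) * gaussBinom ((d p c (k + 1) : ℤ) - (2 * (m : ℤ) - (i : ℤ)))
          ((a : ℤ) - (m : ℤ) - (2 * (m : ℤ) - (i : ℤ))) (p : ℚ) := by
  classical
  rw [alphaOne_eq_sum hkc]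
  have h := sum_regroup (α := Submodule (ZMod p) (FreeNilp p c)) (fun V => V ≤ lieComp p c k)
    (fun V => Module.finrank (ZMod p) V) (fun V => dimCol p c V)
    (fun m i => gaussBinom ((d p c (k + 1) : ℤ) - (2 * (m : ℤ) - (i : ℤ)))
          ((a : ℤ) - (m : ℤ) - (2 * (m : ℤ) - (i : ℤ))) (p : ℚ))
    (d p c k + 1) (fun m => min m (ell p c k) + 1)
    (fun V hV => Nat.lt_succ_of_le (Submodule.finrank_mono hV))
    (fun V hV => Nat.lt_succ_of_le
      (le_min (dimCol_le_finrank hp hk hkc hV) (dimCol_le_ell hV)))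
  refine Eq.trans (Finset.sum_congr rfl fun V _ => ?_) h
  split_ifs with hV
  · have := finrank_sup_add_dimCol hp hk hkc hV
    have e : (Module.finrank (ZMod p) (V.map (phi p c 0) ⊔ V.map (phi p c 1) : Submodule _ _) : ℤ) =
        2 * (Module.finrank (ZMod p) V : ℤ) - (dimCol p c V : ℤ) := by omega
    rw [e]
  · rfl

/-- The part of `L_k` sent by one of the two maps `phi` into `S`. -/
def hull (p c k : ℕ) (S : Submodule (ZMod p) (FreeNilp p c)) :
    Submodule (ZMod p) (FreeNilp p c) :=
  (S.comap (phi p c 0) ⊓ lieComp p c k) ⊔ (S.comap (phi p c 1) ⊓ lieComp p c k)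

lemma hull_le (S : Submodule (ZMod p) (FreeNilp p c)) : hull p c k S ≤ lieComp p c k :=
  sup_le inf_le_right inf_le_right

lemma map_comap_inf {i : Fin 2} {S : Submodule (ZMod p) (FreeNilp p c)}
    (hS : S ≤ (lieComp p c k).map (phi p c i)) :
    (S.comap (phi p c i) ⊓ lieComp p c k).map (phi p c i) = S := by
  refine le_antisymm ?_ fun x hx => ?_
  · rintro _ ⟨x, hx, rfl⟩
    exact hx.1
  · obtain ⟨y, hy, rfl⟩ := hS hx
    exact ⟨y, ⟨hx, hy⟩, rfl⟩

/-- The two preimages of S each have the dimension of S and meet trivially: an element v of both is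
the middle of a chain u, v, w, so u = 0, and injectivity gives v = 0. -/
lemma finrank_hull (hp : c ≤ p) (hk : 2 ≤ k) (hkc : k + 1 ≤ c)
    {S : Submodule (ZMod p) (FreeNilp p c)}
    (hS : S ≤ (lieComp p c k).map (phi p c 0) ⊓ (lieComp p c k).map (phi p c 1)) :
    Module.finrank (ZMod p) (hull p c k S) = 2 * Module.finrank (ZMod p) S := by
  have h : ∀ i, S ≤ (lieComp p c k).map (phi p c i) → Module.finrank (ZMod p)
      (S.comap (phi p c i) ⊓ lieComp p c k : Submodule _ _) = Module.finrank (ZMod p) S := by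
    intro i hi
    rw [← finrank_map_phi hp hk hkc inf_le_right i, map_comap_inf hi]
  have h0 := hS.trans inf_le_left
  have h1 := hS.trans inf_le_right
  have hdisj : (S.comap (phi p c 0) ⊓ lieComp p c k) ⊓ (S.comap (phi p c 1) ⊓ lieComp p c k) =
      ⊥ := by
    rw [eq_bot_iff]
    rintro v ⟨⟨hv0, hv⟩, ⟨hv1, _⟩⟩
    obtain ⟨w, hw, hw'⟩ := h1 hv0
    obtain ⟨u, hu, hu'⟩ := h0 hv1
    have hu0 := (phi_chain hp hk hkc hu hv hw hu' hw'.symm).1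
    rw [hu0, map_zero] at hu'
    exact phi_injOn hp hk hkc 1 hv hu'.symm
  have := Submodule.finrank_sup_add_finrank_inf_eq (S.comap (phi p c 0) ⊓ lieComp p c k)
    (S.comap (phi p c 1) ⊓ lieComp p c k)
  rw [hdisj, finrank_bot, h 0 h0, h 1 h1] at this
  rw [hull]
  omega

/-- By injectivity the preimage of S in `L_k` under each map is the only candidate for its preimage
in V. Thus containing S in the collapse of V means containing a fixed subspace in V, which is an
interval condition. -/
lemma le_inf_map_iff (hp : c ≤ p) (hk : 2 ≤ k) (hkc : k + 1 ≤ c)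
    {S : Submodule (ZMod p) (FreeNilp p c)} (hV : V ≤ lieComp p c k) :
    S ≤ V.map (phi p c 0) ⊓ V.map (phi p c 1) ↔
      S ≤ (lieComp p c k).map (phi p c 0) ⊓ (lieComp p c k).map (phi p c 1) ∧
        hull p c k S ≤ V := by
  constructor
  · intro h
    refine ⟨h.trans (inf_le_inf (Submodule.map_mono hV) (Submodule.map_mono hV)), ?_⟩
    have key : ∀ i, S ≤ V.map (phi p c i) → S.comap (phi p c i) ⊓ lieComp p c k ≤ V := by
      rintro i hi x ⟨hx, hxk⟩
      obtain ⟨v, hv, hvx⟩ := hi hx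
      have : x - v = 0 := phi_injOn hp hk hkc i (sub_mem hxk (hV hv))
        (by rw [map_sub, hvx, sub_self])
      rwa [sub_eq_zero.1 this]
    exact sup_le (key 0 (h.trans inf_le_left)) (key 1 (h.trans inf_le_right))
  · rintro ⟨h, h'⟩
    refine le_inf ?_ ?_
    · rw [← map_comap_inf (h.trans inf_le_left)]
      exact Submodule.map_mono (le_sup_left.trans h')
    · rw [← map_comap_inf (h.trans inf_le_right)]
      exact Submodule.map_mono (le_sup_right.trans h')

/-- Double counting of the pairs formed by a subspace `V` of `L_k` of dimension `m` and a subspace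
of `φ_1(V) ∩ φ_2(V)` of dimension `e`. -/
lemma sum_f_mul_gaussBinom (hp : c ≤ p) (hk : 2 ≤ k) (hkc : k + 1 ≤ c) (m e : ℕ) :
    ∑ i ∈ Finset.range (ell p c k + 1), (f p c k m i : ℚ) * gaussBinom i e (p : ℚ) =
      gaussBinom (ell p c k) e (p : ℚ) *
        gaussBinom ((d p c k : ℤ) - 2 * e) ((m : ℤ) - 2 * e) (p : ℚ) := by
  classical
  set E := lieComp p c k with hE
  set Q : Set (Submodule (ZMod p) (FreeNilp p c) × Submodule (ZMod p) (FreeNilp p c)) :=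
    {x | (x.2 ≤ E ∧ Module.finrank (ZMod p) x.2 = m) ∧ Module.finrank (ZMod p) x.1 = e ∧
      x.1 ≤ x.2.map (phi p c 0) ⊓ x.2.map (phi p c 1)} with hQ
  have h1 : (Q.ncard : ℚ) = ∑ i ∈ Finset.range (ell p c k + 1),
      (f p c k m i : ℚ) * gaussBinom i e (p : ℚ) := by
    -- The dimension m is already fixed in the predicate, so the first statistic is a dummy and only
    -- the collapse is used for grouping.
    have hr := sum_regroup (α := Submodule (ZMod p) (FreeNilp p c))
      (fun V => V ≤ E ∧ Module.finrank (ZMod p) V = m)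
      (fun _ => 0) (fun V => dimCol p c V) (fun _ i => gaussBinom i e (p : ℚ)) 1
      (fun _ => ell p c k + 1) (fun _ _ => Nat.one_pos)
      (fun V hV => Nat.lt_succ_of_le (dimCol_le_ell hV.1))
    rw [Finset.sum_range_one] at hr
    have hf : ∀ i, {V : Submodule (ZMod p) (FreeNilp p c) |
        (V ≤ E ∧ Module.finrank (ZMod p) V = m) ∧ dimCol p c V = i}.ncard =
          f p c k m i := by
      intro i
      rw [f]
      congr 1
      ext V
      simp [hE, and_assoc]
    simp only [true_and, hf] at hr
    rw [← hr, ncard_eq_sum_ncard', Nat.cast_sum]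
    refine Finset.sum_congr rfl fun V _ => ?_
    split_ifs with hV
    · have h2 := ncard_interval (p := p) (A := ⊥) (bot_le (a := V.map (phi p c 0) ⊓
        V.map (phi p c 1))) e
      rw [finrank_bot, Nat.cast_zero, sub_zero, sub_zero] at h2
      rw [dimCol, ← h2]
      congr 2
      ext S
      simp only [hQ, Set.mem_ofPred_eq, hV, bot_le, true_and, Nat.cast_inj, and_comm]
    · rw [Nat.cast_eq_zero, Set.ncard_eq_zero]
      exact Set.eq_empty_of_forall_notMem fun S h => hV h.1
  have h2 : (Q.ncard : ℚ) = gaussBinom (ell p c k) e (p : ℚ) *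
        gaussBinom ((d p c k : ℤ) - 2 * e) ((m : ℤ) - 2 * e) (p : ℚ) := by
    have h3 := ncard_interval (p := p) (A := ⊥) (bot_le (a := E.map (phi p c 0) ⊓
        E.map (phi p c 1))) e
    rw [finrank_bot, Nat.cast_zero, sub_zero, sub_zero] at h3
    simp only [bot_le, true_and, Nat.cast_inj] at h3
    rw [ell, dimCol, ← h3, ← sum_ite_const, ncard_eq_sum_ncard, Nat.cast_sum]
    refine Finset.sum_congr rfl fun S _ => ?_
    split_ifs with hS
    · have h4 := ncard_interval (p := p) (hull_le (k := k) S) m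
      rw [finrank_hull hp hk hkc hS.1, hS.2] at h4
      push_cast at h4
      rw [d, ← h4]
      congr 2
      ext V
      simp only [hQ, Set.mem_ofPred_eq, Nat.cast_inj]
      constructor
      · rintro ⟨⟨hV, hm⟩, _, hle⟩
        exact ⟨((le_inf_map_iff hp hk hkc hV).1 hle).2, hV, hm⟩
      · rintro ⟨hle, hV, hm⟩
        exact ⟨⟨hV, hm⟩, hS.2, (le_inf_map_iff hp hk hkc hV).2 ⟨hS.1, hle⟩⟩
    · rw [Nat.cast_eq_zero, Set.ncard_eq_zero]
      refine Set.eq_empty_of_forall_notMem ?_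
      rintro V ⟨⟨hV, _⟩, he, hle⟩
      exact hS ⟨((le_inf_map_iff hp hk hkc hV).1 hle).1, he⟩
  rw [← h1, h2]

end HighWeight

/-! ### Inverting the double-counting relations. -/

section Polynomiality

lemma exists_gaussBinom_poly (n i : ℤ) :
    ∃ P : ℚ[X], ∀ (p : ℕ) [Fact p.Prime], gaussBinom n i (p : ℚ) = P.eval (p : ℚ) :=
  ⟨_, fun _ _ => gaussBinom_eq_eval one_lt_cast_prime n i⟩

lemma f_eq_zero_of_ell_lt {p c k m i : ℕ} [Fact p.Prime] (h : ell p c k < i) :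
    f p c k m i = 0 := by
  rw [f, Set.ncard_eq_zero]
  refine Set.eq_empty_of_forall_notMem ?_
  rintro V ⟨hV, _, hi⟩
  have := dimCol_le_ell hV
  omega

/-- The numbers `f_k(m, e, p)` are polynomials in `p`. -/
lemma exists_f_poly {c k D l : ℕ} (hk : 2 ≤ k) (hkc : k + 1 ≤ c)
    (hD : ∀ (p : ℕ) [Fact p.Prime], c ≤ p → d p c k = D)
    (hl : ∀ (p : ℕ) [Fact p.Prime], c ≤ p → ell p c k = l) (m : ℕ) :
    ∀ n e : ℕ, l < e + n → ∃ P : ℚ[X], ∀ (p : ℕ) [Fact p.Prime], c ≤ p →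
      (f p c k m e : ℚ) = P.eval (p : ℚ) := by
  intro n
  induction n with
  | zero =>
    intro e he
    refine ⟨0, fun p _ hp => ?_⟩
    rw [f_eq_zero_of_ell_lt (by rw [hl p hp]; omega)]
    simp
  | succ n ih =>
    intro e he
    rcases lt_or_ge l e with hle | hle
    · refine ⟨0, fun p _ hp => ?_⟩
      rw [f_eq_zero_of_ell_lt (by rw [hl p hp]; omega)]
      simp
    -- All f(m, i) with i > e are polynomial by descending induction. In the relation for e the
    -- terms with i < e vanish and f(m, e) has coefficient 1, so it can be solved for.
    choose P hP using fun j : ℕ => ih (e + 1 + j) (by omega)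
    obtain ⟨G, hG⟩ := exists_gaussBinom_poly l e
    obtain ⟨G', hG'⟩ := exists_gaussBinom_poly ((D : ℤ) - 2 * e) ((m : ℤ) - 2 * e)
    refine ⟨G * G' - ∑ j ∈ Finset.range (l - e), P j * gaussPoly (e + 1 + j) e,
      fun p _ hp => ?_⟩
    have h := sum_f_mul_gaussBinom hp hk hkc m e
    rw [hl p hp, hD p hp, hG, hG'] at h
    have hsplit : l + 1 = e + (1 + (l - e)) := by omega
    rw [hsplit, Finset.sum_range_add, Finset.sum_eq_zero, zero_add, Finset.sum_range_add,
      Finset.sum_range_one] at h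
    · rw [add_zero, gaussBinom_natCast one_lt_cast_prime, gaussPoly_self, eval_one, mul_one] at h
      rw [eval_sub, eval_mul, eval_finsetSum, ← h]
      simp only [eval_mul, ← hP _ p hp, ← gaussBinom_natCast (one_lt_cast_prime (p := p)),
        ← add_assoc, add_sub_cancel_right]
    · intro i hi
      rw [gaussBinom_natCast one_lt_cast_prime, gaussPoly_of_lt (Finset.mem_range.1 hi), eval_zero,
        mul_zero]

lemma exists_alphaOne_poly_of_two_le {c k : ℕ} (hk : 2 ≤ k) (hkc : k + 1 ≤ c) (a : ℕ) :
    ∃ P : ℚ[X], ∀ (p : ℕ) [Fact p.Prime], c ≤ p →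
      (alphaOne p c k a : ℚ) = P.eval (p : ℚ) := by
  obtain ⟨D, hD⟩ := exists_d_eq (k := k) (by omega)
  obtain ⟨D', hD'⟩ := exists_d_eq (k := k + 1) (by omega)
  have hd : ∀ (p : ℕ) [Fact p.Prime], c ≤ p → d p c k = D := fun p _ hp => hD p c (by omega) hp
  -- The natural subtraction does not truncate, since D' + l_{k+1} = 2D.
  have hl : ∀ (p : ℕ) [Fact p.Prime], c ≤ p → ell p c k = 2 * D - D' := by
    intro p _ hp
    have h := ell_add_d hp hk hkc
    rw [hd p hp, hD' p c hkc hp] at h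
    omega
  choose F hF using fun m i : ℕ =>
    exists_f_poly hk hkc hd hl m (2 * D - D' + 1) i (by omega)
  choose G hG using fun m i : ℕ => exists_gaussBinom_poly
    ((D' : ℤ) - (2 * (m : ℤ) - (i : ℤ))) ((a : ℤ) - (m : ℤ) - (2 * (m : ℤ) - (i : ℤ)))
  refine ⟨∑ m ∈ Finset.range (D + 1), ∑ i ∈ Finset.range (min m (2 * D - D') + 1),
    F m i * G m i, fun p _ hp => ?_⟩
  rw [alphaOne_formula hp hk hkc, hd p hp, hl p hp, hD' p c hkc hp]
  simp only [eval_finsetSum, eval_mul, ← hF _ _ p hp, ← hG]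

end Polynomiality

/-! ### Weight 1, where [X_i, X_i] = 0 destroys injectivity. -/

section WeightOne

variable {p c : ℕ} [Fact p.Prime]

/-- The letters in the nilpotent quotient. -/
def gen (p c : ℕ) (i : Fin 2) : FreeNilp p c := proj p c (freeGen p i)

lemma lieComp_one : lieComp p c 1 = Submodule.span (ZMod p) {gen p c 0, gen p c 1} := by
  rw [lieComp, ← rightNormed_eq, rightNormed, Submodule.map_span, ← Set.range_comp]
  congr 1
  ext x
  simp [gen, eq_comm]

omit [Fact p.Prime] in
lemma phi_apply (i : Fin 2) (x : FreeNilp p c) : phi p c i x = ⁅gen p c i, x⁆ := rfl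

lemma lie_gen_ne_zero (hc : 2 ≤ c) : ⁅gen p c 0, gen p c 1⁆ ≠ 0 := by
  intro h
  rw [← phi_apply, gen, phi_proj] at h
  have h1 := coeff_eq_zero_of_proj_eq_zero h (w := [0, 1]) (by simpa using hc)
  rw [coe_lie_freeGen, map_sub] at h1
  have e : ((freeGen p 1 : freeLie p) : FreeAlgebra (ZMod p) (Fin 2)) = monom (ZMod p) [1] := by
    simp [freeGen]
  have e' : FreeAlgebra.ι (ZMod p) (0 : Fin 2) = monom (ZMod p) [0] := by simp
  rw [e, e', ← monom_append, ← monom_append, coeff_monom, coeff_monom] at h1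
  simp at h1

/-- All brackets of letters are multiples of z = [X₁, X₂]; an element aX₁ + bX₂ is sent to bz and
-az, so any nonzero element already yields z. -/
lemma finrank_sup_map_phi_of_weight_one (hc : 2 ≤ c) {J : Submodule (ZMod p) (FreeNilp p c)}
    (hJ : J ≤ lieComp p c 1) (h0 : J ≠ ⊥) :
    Module.finrank (ZMod p) (J.map (phi p c 0) ⊔ J.map (phi p c 1) : Submodule _ _) = 1 := by
  set z := ⁅gen p c 0, gen p c 1⁆ with hz
  have hz' : ⁅gen p c 1, gen p c 0⁆ = -z := by rw [hz, lie_skew]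
  have hphi : ∀ x ∈ lieComp p c 1, ∃ a b : ZMod p, x = a • gen p c 0 + b • gen p c 1 ∧
      phi p c 0 x = b • z ∧ phi p c 1 x = -(a • z) := by
    intro x hx
    rw [lieComp_one, Submodule.mem_span_pair] at hx
    obtain ⟨a, b, rfl⟩ := hx
    have h00 : phi p c 0 (gen p c 0) = 0 := by rw [phi_apply]; exact lie_self _
    have h01 : phi p c 0 (gen p c 1) = z := rfl
    have h10 : phi p c 1 (gen p c 0) = -z := hz'
    have h11 : phi p c 1 (gen p c 1) = 0 := by rw [phi_apply]; exact lie_self _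
    refine ⟨a, b, rfl, ?_, ?_⟩
    · rw [map_add, map_smul, map_smul, h00, h01, smul_zero, zero_add]
    · rw [map_add, map_smul, map_smul, h10, h11, smul_zero, add_zero, smul_neg]
  suffices J.map (phi p c 0) ⊔ J.map (phi p c 1) = Submodule.span (ZMod p) {z} by
    rw [this]
    exact finrank_span_singleton (lie_gen_ne_zero hc)
  refine le_antisymm (sup_le ?_ ?_) ?_
  · rintro _ ⟨x, hx, rfl⟩
    obtain ⟨a, b, -, h, -⟩ := hphi x (hJ hx)
    rw [h]
    exact Submodule.smul_mem _ _ (Submodule.mem_span_singleton_self z)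
  · rintro _ ⟨x, hx, rfl⟩
    obtain ⟨a, b, -, -, h⟩ := hphi x (hJ hx)
    rw [h]
    exact neg_mem (Submodule.smul_mem _ _ (Submodule.mem_span_singleton_self z))
  · obtain ⟨x, hx, hx0⟩ := Submodule.exists_mem_ne_zero_of_ne_bot h0
    obtain ⟨a, b, hab, h1, h2⟩ := hphi x (hJ hx)
    rw [Submodule.span_singleton_le_iff_mem]
    by_cases hb : b = 0
    · have ha : a ≠ 0 := by
        rintro rfl
        exact hx0 (by rw [hab, hb]; simp)
      refine Submodule.mem_sup_right ?_
      have : z = phi p c 1 ((-a⁻¹) • x) := by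
        rw [map_smul, h2, smul_neg, neg_smul, neg_neg, smul_smul, inv_mul_cancel₀ ha, one_smul]
      rw [this]
      exact Submodule.mem_map_of_mem (J.smul_mem _ hx)
    · refine Submodule.mem_sup_left ?_
      have : z = phi p c 0 (b⁻¹ • x) := by
        rw [map_smul, h1, smul_smul, inv_mul_cancel₀ hb, one_smul]
      rw [this]
      exact Submodule.mem_map_of_mem (J.smul_mem _ hx)

/-- The term min(m, 1) is dim(φ₁(J) + φ₂(J)): it is 0 for J = 0 and 1 for every other J, so grouping
by m alone suffices. -/
lemma alphaOne_weight_one (hc : 2 ≤ c) (a : ℕ) : (alphaOne p c 1 a : ℚ) =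
    ∑ m ∈ Finset.range 3, gaussBinom 2 m (p : ℚ) *
      gaussBinom ((d p c 2 : ℤ) - min m 1) ((a : ℤ) - m - min m 1) (p : ℚ) := by
  classical
  rw [alphaOne_eq_sum hc]
  have h := sum_regroup (α := Submodule (ZMod p) (FreeNilp p c)) (fun V => V ≤ lieComp p c 1)
    (fun V => Module.finrank (ZMod p) V) (fun _ => 0)
    (fun m _ => gaussBinom ((d p c 2 : ℤ) - min m 1) ((a : ℤ) - m - min m 1) (p : ℚ))
    3 (fun _ => 1) (fun V hV => ?_) (fun _ _ => Nat.one_pos)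
  · refine Eq.trans (Finset.sum_congr rfl fun V _ => ?_)
      (h.trans (Finset.sum_congr rfl fun m _ => ?_))
    · split_ifs with hV
      · by_cases h0 : V = ⊥
        · subst h0
          rw [Submodule.map_bot, Submodule.map_bot, sup_idem]
          simp
        · rw [finrank_sup_map_phi_of_weight_one hc hV h0]
          have : 1 ≤ Module.finrank (ZMod p) V := by
            rw [Nat.one_le_iff_ne_zero]
            exact fun h => h0 (Submodule.finrank_eq_zero.1 h)
          rw [min_eq_right (by exact_mod_cast this)]
      · rfl
    · rw [Finset.sum_range_one]
      congr 1
      have h2 := ncard_interval (p := p) (A := ⊥) (bot_le (a := lieComp p c 1)) m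
      rw [finrank_bot, Nat.cast_zero, sub_zero, sub_zero, ← d, d_one (by omega)] at h2
      rw [Nat.cast_ofNat] at h2
      rw [← h2]
      congr 2
      ext V
      simp
  · have := Submodule.finrank_mono hV
    rw [← d, d_one (by omega)] at this
    omega

lemma exists_alphaOne_poly_one {c : ℕ} (hc : 2 ≤ c) (a : ℕ) :
    ∃ P : ℚ[X], ∀ (p : ℕ) [Fact p.Prime], c ≤ p →
      (alphaOne p c 1 a : ℚ) = P.eval (p : ℚ) := by
  obtain ⟨D, hD⟩ := exists_d_eq (k := 2) (by omega)
  choose G hG using fun m : ℕ => exists_gaussBinom_poly 2 m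
  choose G' hG' using fun m : ℕ => exists_gaussBinom_poly
    ((D : ℤ) - min m 1) ((a : ℤ) - m - min m 1)
  refine ⟨∑ m ∈ Finset.range 3, G m * G' m, fun p _ hp => ?_⟩
  rw [alphaOne_weight_one hc, hD p c hc hp]
  simp only [eval_finsetSum, eval_mul, ← hG, ← hG']

end WeightOne

end GradedIdeals

end

theorem mainTheorem6 (c k a : ℕ) (hk : 1 ≤ k) (hkc : k + 1 ≤ c) :
    (2 ≤ k → ∀ (p : ℕ) [Fact p.Prime], c ≤ p →
      (GradedIdeals.alphaOne p c k a : ℚ) =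
        ∑ m ∈ Finset.range (GradedIdeals.d p c k + 1),
          ∑ i ∈ Finset.range (min m (GradedIdeals.ell p c k) + 1),
            (GradedIdeals.f p c k m i : ℚ) *
              GradedIdeals.gaussBinom
                ((GradedIdeals.d p c (k + 1) : ℤ) - (2 * (m : ℤ) - (i : ℤ)))
                ((a : ℤ) - (m : ℤ) - (2 * (m : ℤ) - (i : ℤ))) (p : ℚ)) ∧
    (∃ P : ℚ[X], ∀ (p : ℕ) [Fact p.Prime], c ≤ p →
      (GradedIdeals.alphaOne p c k a : ℚ) = P.eval (p : ℚ)) := by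
  refine ⟨fun hk2 p _ hp => GradedIdeals.alphaOne_formula hp hk2 hkc a, ?_⟩
  obtain rfl | hk2 := hk.eq_or_lt
  · exact GradedIdeals.exists_alphaOne_poly_one hkc a
  · exact GradedIdeals.exists_alphaOne_poly_of_two_le hk2 hkc a
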